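/- Let $k\ge 1$ and $s\ge -\tfrac12$, and let $\mathcal P(\mathbb R^{+k})$ be the set of Borel probability measures on the cone $\mathbb R^{+k}=[0,\infty)^k$, with Euclidean norm $\|\cdot\|$. \emph{Definitions.} For $x,y\ge 0$ let $\delta_x\circ_s\delta_y$ be the law of $(x^2+2uxy+y^2)^{1/2}$, where $u$ is distributed on $[-1,1]$ with density $\frac{\Gamma(s+1)}{\sqrt\pi\,\Gamma(s+1/2)}(1-u^2)^{s-1/2}$ (for $s=-\tfrac12$: $u=\pm1$ with probability $\tfrac12$ each). For $\mathbf x,\mathbf y\in\mathbb R^{+k}$ put $\delta_{\mathbf x}\bigcirc_{s,k}\delta_{\mathbf y}=(\delta_{x_1}\circ_s\delta_{y_1})\times\cdots\times(\delta_{x_k}\circ_s\delta_{y_k})$, and for $G_1,G_2\in\mathcal P(\mathbb R^{+k})$ put $G_1\bigcirc_{s,k}G_2=\iint \delta_{\mathbf x}\bigcirc_{s,k}\delta_{\mathbf y}\,G_1(d\mathbf x)\,G_2(d\mathbf y)$. A measure $\mu\in\mathcal P(\mathbb R^{+k})$ is $\bigcirc_{s,k}$-infinitely divisible if for every $m=1,2,\dots$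 there is $\mu_m\in\mathcal P(\mathbb R^{+k})$ whose $m$-fold $\bigcirc_{s,k}$-power is $\mu$. Let $\Lambda_s(x)=\Gamma(s+1)J_s(x)/(x/2)^s$ for $x>0$ and $\Lambda_s(0)=1$, where $J_s$ is the Bessel function of the first kind, and let $\hat\mu(\mathbf t)=\int\prod_{j=1}^k\Lambda_s(t_jx_j)\,\mu(d\mathbf x)$, $\mathbf t\in\mathbb R^{+k}$. Let $\sigma_s$ be the law on $(0,\infty)$ with density $\frac{2(s+1)^{s+1}}{\Gamma(s+1)}x^{2s+1}e^{-(s+1)x^2}$. A law is Rayleighian if it equals $T_{\lambda_1}\sigma_s\times\cdots\times T_{\lambda_k}\sigma_s$ for some $\lambda_j\ge0$, where $T_c$ denotes the image under $x\mapsto cx$. \emph{Representation.} Say that $\mu\in\mathcal P(\mathbb R^{+k})$ is represented by a pair $[M,\lambda]$ if $\lambda=(\lambda_1,\dots,\lambda_k)$ with $\lambda_j\ge0$; $M$ is a $\sigma$-finite Borel measure on $\mathbb R^{+k}$ with $M(\{\mathbf 0\})=0$, finite outside every neighbourhood of $\mathbf 0$, with $\int\frac{\|\mathbf x\|^2}{1+\|\mathbf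 x\|^2}M(d\mathbf x)<\infty$; and, for every $\mathbf t\in\mathbb R^{+k}$, $\hat\mu(\mathbf t)>0$, the integral below converges, and $$-\log\hat\mu(\mathbf t)=\sum_{j=1}^k\lambda_j^2t_j^2+\int_{\mathbb R^{+k}\setminus\{\mathbf 0\}}\Bigl(1-\prod_{j=1}^k\Lambda_s(t_jx_j)\Bigr)\frac{1+\|\mathbf x\|^2}{\|\mathbf x\|^2}\,M(d\mathbf x).$$ \textbf{Theorem.} Let $\mu\in\mathcal P(\mathbb R^{+k})$. Then: (i) $\mu$ is $\bigcirc_{s,k}$-infinitely divisible if and only if it is represented by some pair $[M,\lambda]$. (ii) The representation is unique: if $\mu$ is represented by $[M,\lambda]$ and by $[M',\lambda']$, then $M=M'$ and $\lambda=\lambda'$. (iii) $\mu$ is represented by $[0,\lambda]$ for some $\lambda$ if and only if $\mu$ is Rayleighian; and $\mu$ is Rayleighian if and only if there are $\lambda_j\ge0$ with $\hat\mu(\mathbf t)>0$ and $-\log\hat\mu(\mathbf t)=\frac12\sum_{j=1}^k\lambda_j^2t_j^2$ for all $\mathbf t\in\mathbb R^{+k}$. -/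

import Mathlib

open MeasureTheory Set Filter Topology
open scoped NNReal ENNReal

/-- Bessel function of the first kind, `J_s(x) = ∑ (-1)^m (x/2)^(s+2m) / (m! Γ(s+m+1))`, `x > 0`. -/
noncomputable def besselJ (s x : ℝ) : ℝ :=
  ∑' m : ℕ, (-1) ^ m * (x / 2) ^ (s + 2 * (m : ℝ)) / ((m.factorial : ℝ) * Real.Gamma (s + m + 1))

/-- The kernel `Λ_s(x) = Γ(s+1) J_s(x) / (x/2)^s`, written as a power series so that it has the
right value `1` at `x = 0`; see `kingmanKernel_eq_besselJ`. -/
noncomputable def kingmanKernel (s x : ℝ) : ℝ :=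
  ∑' m : ℕ, (-1) ^ m * Real.Gamma (s + 1) / ((m.factorial : ℝ) * Real.Gamma (s + m + 1))
    * (x / 2) ^ (2 * m)

theorem kingmanKernel_eq_besselJ (s : ℝ) {x : ℝ} (hx : 0 < x) :
    kingmanKernel s x = Real.Gamma (s + 1) * besselJ s x / (x / 2) ^ s := by
  have h2 : 0 < x / 2 := by positivity
  have hs : (x / 2) ^ s ≠ 0 := (Real.rpow_pos_of_pos h2 s).ne'
  unfold kingmanKernel besselJ
  rw [← tsum_mul_left, ← tsum_div_const]
  refine tsum_congr fun m => ?_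
  have : (x / 2) ^ (s + 2 * (m : ℝ)) = (x / 2) ^ s * (x / 2) ^ (2 * m) := by
    rw [Real.rpow_add h2, ← Real.rpow_natCast (x / 2) (2 * m)]
    push_cast
    rfl
  rw [this]
  field_simp

theorem kingmanKernel_zero {s : ℝ} (hs : -(1 / 2) ≤ s) : kingmanKernel s 0 = 1 := by
  have hG : Real.Gamma (s + 1) ≠ 0 := (Real.Gamma_pos_of_pos (by linarith)).ne'
  unfold kingmanKernel
  rw [tsum_eq_single 0]
  · simp [hG]
  · intro m hm
    simp [hm]

/-- The law of the cosine `u` of the angle in the Kingman convolution: density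
`Γ(s+1) / (√π Γ(s+1/2)) (1-u²)^(s-1/2)` on `(-1, 1)` for `s > -1/2`, and its weak limit, the
uniform law on `{-1, 1}`, for `s = -1/2`. -/
noncomputable def angleLaw (s : ℝ) : Measure ℝ :=
  if s = -(1 / 2) then
    (2⁻¹ : ℝ≥0∞) • Measure.dirac (-1) + (2⁻¹ : ℝ≥0∞) • Measure.dirac 1
  else
    (volume.restrict (Ioo (-1) 1)).withDensity fun u =>
      ENNReal.ofReal (Real.Gamma (s + 1) / (Real.sqrt Real.pi * Real.Gamma (s + 1 / 2))
        * (1 - u ^ 2) ^ (s - 1 / 2))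

theorem isProbabilityMeasure_angleLaw {s : ℝ} (hs : -(1 / 2) ≤ s) :
    IsProbabilityMeasure (angleLaw s) := by
  constructor
  unfold angleLaw
  split_ifs with h
  · simp [ENNReal.inv_two_add_inv_two]
  · have ha : 0 < s + 1 / 2 := by
      rcases lt_or_eq_of_le hs with h1 | h1
      · linarith
      · exact absurd h1.symm h
    rw [withDensity_apply _ MeasurableSet.univ, Measure.restrict_univ]
    have himg : (fun v : ℝ => 2 * v + (-1)) '' Ioo 0 1 = Ioo (-1) 1 := by
      rw [Set.image_affine_Ioo (by norm_num)]
      norm_num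
    rw [← himg, lintegral_image_eq_lintegral_abs_deriv_mul (f' := fun _ => 2) measurableSet_Ioo
      (fun x _ => by
        simpa using (((hasDerivAt_id x).const_mul 2).add_const (-1)).hasDerivWithinAt)
      (fun x _ y _ hxy => by simpa using hxy)]
    rw [← ProbabilityTheory.lintegral_betaPDF_eq_one ha ha, ProbabilityTheory.lintegral_betaPDF]
    refine setLIntegral_congr_fun measurableSet_Ioo fun v hv => ?_
    have hv0 : 0 < v := hv.1
    have hv1 : 0 < 1 - v := by linarith [hv.2]
    rw [← ENNReal.ofReal_mul (abs_nonneg _)]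
    congr 1
    have hsq : 1 - (2 * v + -1) ^ 2 = 2 ^ (2 : ℝ) * (v * (1 - v)) := by
      norm_num
      ring
    have hG := Real.Gamma_mul_Gamma_add_half (s + 1 / 2)
    have e1 : s + 1 / 2 + 1 / 2 = s + 1 := by ring
    have e2 : s + 1 / 2 - 1 = s - 1 / 2 := by ring
    have e3 : s + 1 / 2 + (s + 1 / 2) = 2 * (s + 1 / 2) := by ring
    rw [e1] at hG
    rw [hsq, Real.mul_rpow (by positivity) (by positivity), Real.mul_rpow hv0.le hv1.le,
      ← Real.rpow_mul (by norm_num), ProbabilityTheory.beta, e2, e3]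
    have h1 : 0 < Real.Gamma (s + 1 / 2) := Real.Gamma_pos_of_pos ha
    have h2 : 0 < Real.Gamma (2 * (s + 1 / 2)) := Real.Gamma_pos_of_pos (by linarith)
    have h3 : 0 < Real.sqrt Real.pi := Real.sqrt_pos.mpr Real.pi_pos
    have h4 : Real.Gamma (s + 1) =
        Real.Gamma (2 * (s + 1 / 2)) * 2 ^ (1 - 2 * (s + 1 / 2)) * Real.sqrt Real.pi
          / Real.Gamma (s + 1 / 2) := by
      rw [eq_div_iff h1.ne', mul_comm, hG]
    have h5 : (2 : ℝ) ^ (1 - 2 * (s + 1 / 2)) * 2 ^ (2 * (s - 1 / 2)) * 2 = 1 := by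
      rw [← Real.rpow_add (by norm_num), ← Real.rpow_add_one (by norm_num)]
      have : 1 - 2 * (s + 1 / 2) + 2 * (s - 1 / 2) + 1 = 0 := by ring
      rw [this, Real.rpow_zero]
    rw [h4, abs_of_pos (by norm_num : (0 : ℝ) < 2)]
    generalize Real.Gamma (s + 1 / 2) = A at h1 ⊢
    generalize Real.Gamma (2 * (s + 1 / 2)) = B at h2 ⊢
    generalize Real.sqrt Real.pi = C at h3 ⊢
    generalize (2 : ℝ) ^ (1 - 2 * (s + 1 / 2)) = D at h5 ⊢
    generalize (2 : ℝ) ^ (2 * (s - 1 / 2)) = E at h5 ⊢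
    generalize v ^ (s - 1 / 2) = V
    generalize (1 - v) ^ (s - 1 / 2) = W
    have hL : 2 * (B * D * C / A / (C * A) * (E * (V * W))) =
        (D * E * 2) * (B / (A * A) * V * W) := by
      field_simp
    have hR : 1 / (A * A / B) * V * W = B / (A * A) * V * W := by
      field_simp
    rw [hL, h5, hR, one_mul]

/-- Law of cosines: the side `(x² + 2uxy + y²)^(1/2)`. -/
noncomputable def lawOfCosines (x y : ℝ≥0) (u : ℝ) : ℝ≥0 :=
  NNReal.sqrt (Real.toNNReal ((x : ℝ) ^ 2 + 2 * u * x * y + (y : ℝ) ^ 2))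

/-- The one-dimensional Kingman convolution `δ_x ∘_s δ_y` of two unit masses. -/
noncomputable def kingmanDirac (s : ℝ) (x y : ℝ≥0) : Measure ℝ≥0 :=
  (angleLaw s).map (lawOfCosines x y)

/-- The `k`-dimensional Kingman convolution of unit masses,
`δ_x ○_{s,k} δ_y = (δ_{x_1} ∘_s δ_{y_1}) × ⋯ × (δ_{x_k} ∘_s δ_{y_k})`. -/
noncomputable def kingmanDiracPi {k : ℕ} (s : ℝ) (x y : Fin k → ℝ≥0) : Measure (Fin k → ℝ≥0) :=
  Measure.pi fun j => kingmanDirac s (x j) (y j)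

/-- The mixture in `kingmanConv` is over a measurable family. -/
theorem measurable_kingmanDiracPi {k : ℕ} {s : ℝ} (hs : -(1 / 2) ≤ s) :
    Measurable fun p : (Fin k → ℝ≥0) × (Fin k → ℝ≥0) => kingmanDiracPi s p.1 p.2 := by
  have := isProbabilityMeasure_angleLaw hs
  have hm : Measurable fun q : ((Fin k → ℝ≥0) × (Fin k → ℝ≥0)) × (Fin k → ℝ) =>
      fun j => lawOfCosines (q.1.1 j) (q.1.2 j) (q.2 j) := by
    unfold lawOfCosines
    fun_prop
  have hm1 : ∀ x y : ℝ≥0, Measurable (lawOfCosines x y) := by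
    intro x y
    unfold lawOfCosines
    fun_prop
  have key : (fun p : (Fin k → ℝ≥0) × (Fin k → ℝ≥0) => kingmanDiracPi s p.1 p.2) =
      fun p => (((Measure.pi fun _ : Fin k => angleLaw s).map (Prod.mk p)).map
        fun q : ((Fin k → ℝ≥0) × (Fin k → ℝ≥0)) × (Fin k → ℝ) =>
          fun j => lawOfCosines (q.1.1 j) (q.1.2 j) (q.2 j)) := by
    funext p
    rw [Measure.map_map hm measurable_prodMk_left]
    have : ∀ j, IsProbabilityMeasure ((angleLaw s).map (lawOfCosines (p.1 j) (p.2 j))) :=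
      fun j => Measure.isProbabilityMeasure_map (hm1 _ _).aemeasurable
    unfold kingmanDiracPi kingmanDirac
    rw [← Measure.pi_map_pi fun j => (hm1 _ _).aemeasurable]
    rfl
  rw [key]
  exact (Measure.measurable_map _ hm).comp Measurable.map_prodMk_left

/-- The `k`-dimensional Kingman convolution `G₁ ○_{s,k} G₂ = ∬ δ_x ○_{s,k} δ_y G₁(dx) G₂(dy)` of
measures on the cone `[0, ∞)^k`. -/
noncomputable def kingmanConv {k : ℕ} (s : ℝ) (G₁ G₂ : Measure (Fin k → ℝ≥0)) :
    Measure (Fin k → ℝ≥0) :=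
  (G₁.prod G₂).bind fun p => kingmanDiracPi s p.1 p.2

/-- Convolution powers; the power `0` is the unit element `δ_0`. -/
noncomputable def kingmanPow {k : ℕ} (s : ℝ) (G : Measure (Fin k → ℝ≥0)) :
    ℕ → Measure (Fin k → ℝ≥0)
  | 0 => Measure.dirac 0
  | m + 1 => kingmanConv s (kingmanPow s G m) G

/-- Infinite divisibility with respect to `○_{s,k}`. -/
def IsKingmanID {k : ℕ} (s : ℝ) (μ : Measure (Fin k → ℝ≥0)) : Prop :=
  ∀ m : ℕ, 1 ≤ m → ∃ ν : Measure (Fin k → ℝ≥0), IsProbabilityMeasure ν ∧ μ = kingmanPow s ν m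

/-- The product kernel `∏_j Λ_s(t_j x_j)`. -/
noncomputable def kingmanKernelPi {k : ℕ} (s : ℝ) (t x : Fin k → ℝ≥0) : ℝ :=
  ∏ j, kingmanKernel s ((t j : ℝ) * x j)

/-- The radial characteristic function `μ̂(t) = ∫ ∏_j Λ_s(t_j x_j) μ(dx)`. -/
noncomputable def radCharFun {k : ℕ} (s : ℝ) (μ : Measure (Fin k → ℝ≥0)) (t : Fin k → ℝ≥0) : ℝ :=
  ∫ x, kingmanKernelPi s t x ∂μ

/-- The squared Euclidean norm on the cone. -/
noncomputable def coneNormSq {k : ℕ} (x : Fin k → ℝ≥0) : ℝ := ∑ j, (x j : ℝ) ^ 2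

/-- The conditions on the measure `M`. -/
structure IsLevyMeasure {k : ℕ} (M : Measure (Fin k → ℝ≥0)) : Prop where
  sigmaFinite : SigmaFinite M
  zero : M {0} = 0
  finite_compl : ∀ U ∈ 𝓝 (0 : Fin k → ℝ≥0), M Uᶜ < ∞
  lintegral_lt_top : ∫⁻ x, ENNReal.ofReal (coneNormSq x / (1 + coneNormSq x)) ∂M < ∞

/-- The integrand away from the origin. Its value at `x = 0` is irrelevant, since `M {0} = 0`. -/
noncomputable def levyIntegrand {k : ℕ} (s : ℝ) (t x : Fin k → ℝ≥0) : ℝ :=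
  (1 - kingmanKernelPi s t x) * ((1 + coneNormSq x) / coneNormSq x)

/-- `-log μ̂(t) = ∑_j l_j² t_j² + ∫ (1 - ∏_j Λ_s(t_j x_j)) (1+‖x‖²)/‖x‖² M(dx)` for all `t`, where
`M` satisfies the conditions above and the integral converges; the sum is the contribution
of the origin. -/
structure HasLevyRep {k : ℕ} (s : ℝ) (μ M : Measure (Fin k → ℝ≥0)) (l : Fin k → ℝ≥0) : Prop where
  levy : IsLevyMeasure M
  integrable : ∀ t, Integrable (levyIntegrand s t) M
  pos : ∀ t, 0 < radCharFun s μ t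
  eq : ∀ t, -Real.log (radCharFun s μ t) =
    ∑ j, (l j : ℝ) ^ 2 * (t j : ℝ) ^ 2 + ∫ x, levyIntegrand s t x ∂M

/-- The characteristic measure `σ_s`, with density
`2 (s+1)^(s+1) / Γ(s+1) y^(2s+1) exp (-(s+1) y²)` on `(0, ∞)`. -/
noncomputable def rayleighLaw (s : ℝ) : Measure ℝ≥0 :=
  ((volume.restrict (Ioi (0 : ℝ))).withDensity fun y =>
    ENNReal.ofReal (2 * (s + 1) ^ (s + 1) / Real.Gamma (s + 1) * y ^ (2 * s + 1)
      * Real.exp (-(s + 1) * y ^ 2))).map Real.toNNReal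

/-- Rayleighian distributions `T_{l_1} σ_s × ⋯ × T_{l_k} σ_s`, where `T_c` is the scaling by `c`. -/
def IsRayleighian {k : ℕ} (s : ℝ) (μ : Measure (Fin k → ℝ≥0)) : Prop :=
  ∃ l : Fin k → ℝ≥0, μ = Measure.pi fun j => (rayleighLaw s).map fun x => l j * x

/-!
By the product formula for `Λ_s`, the transform `μ ↦ μ̂` turns the Kingman convolution into the
pointwise product. Averaging the kernel `∏_j Λ_s(t_j x_j)` over Rayleigh laws in `t` gives Gaussians
in `x`, which are closed under multiplication and separate points, so `μ̂` determines `μ`.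

If `μ` is infinitely divisible, let `ν_n` be a root of order `n + 1` with nonnegative transform.
Then `(n + 1) (1 - ν̂_n) → -log μ̂`, and `(n + 1) (1 - ν̂_n(t))` is the integral of the Lévy
integrand against `(n + 1) ‖x‖² / (1 + ‖x‖²) ν_n(dx)`. Near the origin the limit of this integrand
depends on the direction of approach, so these measures are pushed forward to the blow-up of the
cone at the origin, whose points carry the squared direction cosines `x_j² / ‖x‖²` as further
coordinates and to which the integrand extends continuously. A doubling inequality for `1 - Λ_s` and
the Gaussian averages make the images tight. In a weak limit, the mass over the origin contributes
the quadratic term, and the rest is `M`.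

Conversely, when `M` lives away from the origin, the exponent of `[M, λ]` is that of the
convolution of a Rayleighian law and a compound Poisson law; the general case is a limit of these,
and the exponent can be divided by any `m`.

For uniqueness, the averages of `-log μ̂` over the Rayleigh laws are, as a function of their
parameter `a`, the sum of a linear term, which second differences remove, and the integral of
`(1 - exp (-∑ j, a_j x_j²)) (1 + ‖x‖²) / ‖x‖²`, whose second differences are the integrals of
Gaussians against a positive multiple of `M`.
-/

lemma Gamma_add_natCast {a : ℝ} (ha : 0 < a) (n : ℕ) :
    Real.Gamma (a + n) = Real.Gamma a * (ascPochhammer ℝ n).eval a := by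
  induction n with
  | zero => simp
  | succ n ih =>
    rw [Nat.cast_succ, ← add_assoc, Real.Gamma_add_one (by positivity), ih,
      ascPochhammer_succ_eval]
    ring

lemma ascPochhammer_eval_mul_eval_add {R : Type*} [CommSemiring R] (a : R) (m n : ℕ) :
    (ascPochhammer R m).eval a * (ascPochhammer R n).eval (a + m) =
      (ascPochhammer R (m + n)).eval a := by
  simp [← ascPochhammer_mul R m n]

lemma four_pow_mul_ascPochhammer_half_mul_factorial (p : ℕ) :
    4 ^ p * (ascPochhammer ℝ p).eval (1 / 2) * (p.factorial : ℝ) = ((2 * p).factorial : ℝ) := by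
  induction p with
  | zero => simp
  | succ p ih =>
    rw [mul_add_one, Nat.factorial_succ, Nat.factorial_succ, Nat.factorial_succ,
      ascPochhammer_succ_eval]
    push_cast
    rw [← ih]
    ring

lemma ringChoose_add_sub_one (a : ℝ) (n : ℕ) :
    Ring.choose (a + n - 1) n = (ascPochhammer ℝ n).eval a / n.factorial := by
  rw [← Ring.multichoose_eq, eq_div_iff (by positivity), ← Polynomial.ascPochhammer_smeval_eq_eval,
    ← Ring.factorial_nsmul_multichoose_eq_ascPochhammer, nsmul_eq_mul, mul_comm]

lemma sum_inv_factorial_mul_ascPochhammer {a : ℝ} (ha : 0 < a) (i j : ℕ) :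
    ∑ p ∈ Finset.range (min i j + 1), 1 / ((p.factorial : ℝ) * (i - p).factorial
        * (j - p).factorial * (ascPochhammer ℝ p).eval a) =
      (ascPochhammer ℝ (i + j)).eval a / (i.factorial * j.factorial
        * (ascPochhammer ℝ i).eval a * (ascPochhammer ℝ j).eval a) := by
  have hpos (n : ℕ) : 0 < (ascPochhammer ℝ n).eval a := ascPochhammer_pos n a ha
  have vandermonde : ∑ p ∈ Finset.range (min i j + 1),
      (j.choose p : ℝ) * Ring.choose (a + i - 1) (i - p) = Ring.choose (a + j + i - 1) i := by
    rw [show a + j + i - 1 = j + (a + i - 1) by ring, Ring.add_choose_eq i (Commute.all _ _),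
      Finset.Nat.sum_antidiagonal_eq_sum_range_succ_mk]
    simp only [Ring.choose_natCast]
    refine Finset.sum_subset (Finset.range_mono (by omega)) fun p hp hp' => ?_
    simp only [Finset.mem_range] at hp hp'
    rw [Nat.choose_eq_zero_of_lt (by omega), Nat.cast_zero, zero_mul]
  have term {p : ℕ} (hp : p ∈ Finset.range (min i j + 1)) :
      1 / ((p.factorial : ℝ) * (i - p).factorial * (j - p).factorial
        * (ascPochhammer ℝ p).eval a) = (j.choose p : ℝ) * Ring.choose (a + i - 1) (i - p)
          / (j.factorial * (ascPochhammer ℝ i).eval a) := by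
    obtain ⟨hpi, hpj⟩ : p ≤ i ∧ p ≤ j := by
      simp only [Finset.mem_range] at hp
      omega
    have hsplit := ascPochhammer_eval_mul_eval_add a p (i - p)
    rw [Nat.add_sub_cancel' hpi] at hsplit
    have hshift : 0 < (ascPochhammer ℝ (i - p)).eval (a + p) :=
      ascPochhammer_pos _ _ (by positivity)
    rw [show a + i - 1 = a + p + (i - p : ℕ) - 1 by push_cast [hpi]; ring,
      ringChoose_add_sub_one, Nat.cast_choose ℝ hpj, ← hsplit]
    have := hpos p
    field_simp
  rw [Finset.sum_congr rfl fun p hp => term hp, ← Finset.sum_div, vandermonde,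
    ringChoose_add_sub_one, add_comm i j, ← ascPochhammer_eval_mul_eval_add]
  have := hpos i
  have := hpos j
  field_simp

section AngleLaw

variable {s : ℝ}

lemma angleLaw_neg_half : angleLaw (-(1 / 2)) =
    (2⁻¹ : ℝ≥0∞) • Measure.dirac (-1) + (2⁻¹ : ℝ≥0∞) • Measure.dirac 1 :=
  if_pos rfl

lemma integral_angleLaw_neg_half (f : ℝ → ℝ) :
    ∫ u, f u ∂angleLaw (-(1 / 2)) = (f (-1) + f 1) / 2 := by
  have half_ne_top : (2⁻¹ : ℝ≥0∞) ≠ ∞ := by simp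
  have integrable_half_dirac (c : ℝ) : Integrable f ((2⁻¹ : ℝ≥0∞) • Measure.dirac c) :=
    (integrable_dirac enorm_lt_top).smul_measure half_ne_top
  rw [angleLaw_neg_half, integral_add_measure (integrable_half_dirac _) (integrable_half_dirac _),
    integral_smul_measure, integral_smul_measure, integral_dirac, integral_dirac]
  simp only [ENNReal.toReal_inv, ENNReal.toReal_ofNat, smul_eq_mul]
  ring

lemma integral_angleLaw (hs : -(1 / 2) < s) (f : ℝ → ℝ) :
    ∫ u, f u ∂angleLaw s = ∫ u in Ioo (-1) 1,
      Real.Gamma (s + 1) / (Real.sqrt Real.pi * Real.Gamma (s + 1 / 2))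
        * (1 - u ^ 2) ^ (s - 1 / 2) * f u := by
  unfold angleLaw
  rw [if_neg hs.ne', integral_withDensity_eq_integral_toReal_smul (by fun_prop) (by simp)]
  refine setIntegral_congr_fun measurableSet_Ioo fun u hu => ?_
  have : 0 < 1 - u ^ 2 := by nlinarith [hu.1, hu.2]
  have : 0 < Real.Gamma (s + 1) := Real.Gamma_pos_of_pos (by linarith)
  have : 0 < Real.Gamma (s + 1 / 2) := Real.Gamma_pos_of_pos (by linarith)
  simp only [smul_eq_mul]
  rw [ENNReal.toReal_ofReal (by positivity)]

lemma ae_angleLaw_abs_le : ∀ᵐ u ∂angleLaw s, |u| ≤ 1 := by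
  have hmeas : MeasurableSet {u : ℝ | |u| ≤ 1} := measurableSet_le (by fun_prop) (by fun_prop)
  unfold angleLaw
  split_ifs with h
  · rw [ae_add_measure_iff]
    constructor <;> refine Measure.ae_smul_measure ?_ _ <;> rw [ae_dirac_iff hmeas] <;> simp
  · refine (withDensity_absolutelyContinuous _ _).ae_le ?_
    filter_upwards [ae_restrict_mem measurableSet_Ioo] with u hu
    exact abs_le.2 ⟨hu.1.le, hu.2.le⟩

lemma integrable_angleLaw_of_continuous (hs : -(1 / 2) ≤ s) {f : ℝ → ℝ} (hf : Continuous f) :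
    Integrable f (angleLaw s) := by
  have := isProbabilityMeasure_angleLaw hs
  obtain ⟨C, hC⟩ := (isCompact_Icc (a := (-1 : ℝ)) (b := 1)).exists_bound_of_continuousOn
    hf.continuousOn
  refine Integrable.of_bound hf.aestronglyMeasurable C ?_
  filter_upwards [ae_angleLaw_abs_le] with u hu
  exact hC u (abs_le.1 hu)

lemma hasSum_integral_angleLaw (hs : -(1 / 2) ≤ s) {F : ℕ → ℝ → ℝ} {f : ℝ → ℝ} {b : ℕ → ℝ}
    (hF : ∀ n, Continuous (F n)) (hFb : ∀ n u, |u| ≤ 1 → |F n u| ≤ b n) (hb : Summable b)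
    (hFf : ∀ u, |u| ≤ 1 → HasSum (fun n => F n u) (f u)) :
    HasSum (fun n => ∫ u, F n u ∂angleLaw s) (∫ u, f u ∂angleLaw s) := by
  have := isProbabilityMeasure_angleLaw hs
  refine hasSum_integral_of_dominated_convergence (fun n _ => b n)
    (fun n => (hF n).aestronglyMeasurable) (fun n => ?_) (.of_forall fun _ => hb)
    (integrable_const _) ?_
  · filter_upwards [ae_angleLaw_abs_le] with u hu using hFb n u hu
  · filter_upwards [ae_angleLaw_abs_le] with u hu using hFf u hu

lemma integral_comp_neg_angleLaw (hs : -(1 / 2) ≤ s) (f : ℝ → ℝ) :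
    ∫ u, f (-u) ∂angleLaw s = ∫ u, f u ∂angleLaw s := by
  rcases hs.eq_or_lt with rfl | h
  · simp only [integral_angleLaw_neg_half, neg_neg, add_comm]
  · rw [integral_angleLaw h, integral_angleLaw h,
      ← (Measure.measurePreserving_neg volume).setIntegral_preimage_emb
        (MeasurableEquiv.neg ℝ).measurableEmbedding _ (Ioo (-1) 1)]
    simp

lemma integral_pow_odd_angleLaw (hs : -(1 / 2) ≤ s) {n : ℕ} (hn : Odd n) :
    ∫ u, u ^ n ∂angleLaw s = 0 := by
  have h := integral_comp_neg_angleLaw hs (· ^ n)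
  simp only [hn.neg_pow, integral_neg] at h
  linarith

lemma integral_one_sub_sq_mul_angleLaw (hs : -(1 / 2) ≤ s) (f : ℝ → ℝ) :
    ∫ u, (1 - u ^ 2) * f u ∂angleLaw s =
      (s + 1 / 2) / (s + 1) * ∫ u, f u ∂angleLaw (s + 1) := by
  rcases hs.eq_or_lt with rfl | h
  · rw [integral_angleLaw_neg_half]
    norm_num
  · rw [integral_angleLaw h, integral_angleLaw (by linarith), ← integral_const_mul]
    refine setIntegral_congr_fun measurableSet_Ioo fun u hu => ?_
    have hu' : 0 < 1 - u ^ 2 := by nlinarith [hu.1, hu.2]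
    have hG : 0 < Real.Gamma (s + 1 / 2) := Real.Gamma_pos_of_pos (by linarith)
    have hhalf : s + 1 / 2 ≠ 0 := by linarith
    have hone : s + 1 ≠ 0 := by linarith
    rw [show s + 1 - 1 / 2 = (s - 1 / 2) + 1 by ring, show s + 1 + 1 / 2 = (s + 1 / 2) + 1 by ring,
      Real.Gamma_add_one hhalf, Real.Gamma_add_one hone, Real.rpow_add_one hu'.ne']
    generalize Real.Gamma (s + 1 / 2) = A at hG ⊢
    generalize s + 1 / 2 = b at hhalf ⊢
    field_simp

lemma integral_pow_two_mul_angleLaw (hs : -(1 / 2) ≤ s) (p : ℕ) :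
    ∫ u, u ^ (2 * p) ∂angleLaw s =
      (ascPochhammer ℝ p).eval (1 / 2) / (ascPochhammer ℝ p).eval (s + 1) := by
  induction p generalizing s with
  | zero =>
    have := isProbabilityMeasure_angleLaw hs
    simp
  | succ p ih =>
    have hsplit : ∫ u, u ^ (2 * (p + 1)) ∂angleLaw s =
        ∫ u, u ^ (2 * p) ∂angleLaw s - ∫ u, (1 - u ^ 2) * u ^ (2 * p) ∂angleLaw s := by
      rw [← integral_sub (integrable_angleLaw_of_continuous hs (by fun_prop))
        (integrable_angleLaw_of_continuous hs (by fun_prop))]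
      exact integral_congr_ae (.of_forall fun u => by ring)
    have ha : 0 < s + 1 := by linarith
    have hpos := ascPochhammer_pos p (s + 1) ha
    have hshift : (ascPochhammer ℝ p).eval (s + 1 + 1) =
        (ascPochhammer ℝ p).eval (s + 1) * (s + 1 + p) / (s + 1) := by
      rw [eq_div_iff ha.ne', ← ascPochhammer_succ_eval, add_comm p 1,
        ← ascPochhammer_eval_mul_eval_add (s + 1) 1 p]
      simp [mul_comm]
    rw [hsplit, integral_one_sub_sq_mul_angleLaw hs, ih hs, ih (by linarith),
      ascPochhammer_succ_eval, ascPochhammer_succ_eval, hshift]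
    field_simp
    ring

lemma integral_sq_angleLaw (hs : -(1 / 2) ≤ s) :
    ∫ u, u ^ 2 ∂angleLaw s = 1 / (2 * (s + 1)) := by
  have h := integral_pow_two_mul_angleLaw hs 1
  simp only [mul_one, ascPochhammer_one, Polynomial.eval_X] at h
  rw [h, div_div]

end AngleLaw

section Kernel

/-- The coefficient of `z ^ (2 * m)` in the power series of `Λ_s(z)`. -/
noncomputable def kernelCoeff (s : ℝ) (m : ℕ) : ℝ :=
  (-1) ^ m / ((m.factorial : ℝ) * (ascPochhammer ℝ m).eval (s + 1) * 4 ^ m)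

variable {s : ℝ}

lemma kingmanKernel_eq_tsum (hs : -(1 / 2) ≤ s) (z : ℝ) :
    kingmanKernel s z = ∑' m : ℕ, kernelCoeff s m * (z ^ 2) ^ m := by
  have ha : 0 < s + 1 := by linarith
  unfold kingmanKernel kernelCoeff
  refine tsum_congr fun m => ?_
  have := Real.Gamma_pos_of_pos ha
  have := ascPochhammer_pos m (s + 1) ha
  rw [show s + m + 1 = s + 1 + m by ring, Gamma_add_natCast ha, pow_mul, div_pow, div_pow,
    show ((2 : ℝ) ^ 2) = 4 by norm_num]
  field_simp

lemma one_le_ascPochhammer_eval_mul_four_pow (hs : -(1 / 2) ≤ s) (m : ℕ) :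
    1 ≤ (ascPochhammer ℝ m).eval (s + 1) * 4 ^ m := by
  induction m with
  | zero => simp
  | succ m ih =>
    rw [ascPochhammer_succ_eval, pow_succ, mul_mul_mul_comm]
    have : (0 : ℝ) ≤ m := m.cast_nonneg
    exact one_le_mul_of_one_le_of_one_le ih (by linarith)

lemma abs_kernelCoeff_le (hs : -(1 / 2) ≤ s) (m : ℕ) :
    |kernelCoeff s m| ≤ 1 / (m.factorial : ℝ) := by
  have hpos := ascPochhammer_pos m (s + 1) (by linarith)
  unfold kernelCoeff
  rw [abs_div, abs_pow, abs_neg, abs_one, one_pow, mul_assoc, abs_of_pos (by positivity)]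
  gcongr
  exact le_mul_of_one_le_right (by positivity) (one_le_ascPochhammer_eval_mul_four_pow hs m)

lemma summable_norm_kernelCoeff (hs : -(1 / 2) ≤ s) (w : ℝ) :
    Summable fun m => ‖kernelCoeff s m * w ^ m‖ := by
  refine Summable.of_nonneg_of_le (fun _ => norm_nonneg _) (fun m => ?_)
    (Real.summable_pow_div_factorial |w|)
  rw [norm_mul, norm_pow, Real.norm_eq_abs, Real.norm_eq_abs, div_eq_inv_mul, ← one_div]
  gcongr
  exact abs_kernelCoeff_le hs m

lemma hasSum_kingmanKernel (hs : -(1 / 2) ≤ s) (z : ℝ) :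
    HasSum (fun m => kernelCoeff s m * (z ^ 2) ^ m) (kingmanKernel s z) :=
  kingmanKernel_eq_tsum hs z ▸ (summable_norm_kernelCoeff hs _).of_norm.hasSum

/-- Poisson's integral representation. -/
lemma kingmanKernel_eq_integral_cos (hs : -(1 / 2) ≤ s) (z : ℝ) :
    kingmanKernel s z = ∫ u, Real.cos (z * u) ∂angleLaw s := by
  have termwise := hasSum_integral_angleLaw hs
    (F := fun n u => (-1) ^ n * (z * u) ^ (2 * n) / ((2 * n).factorial : ℝ))
    (f := fun u => Real.cos (z * u)) (b := fun n => |z| ^ (2 * n) / ((2 * n).factorial : ℝ))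
    (fun n => by fun_prop)
    (fun n u hu => by
      rw [abs_div, abs_mul, abs_pow, abs_neg, abs_one, one_pow, one_mul, abs_pow, abs_mul,
        Nat.abs_cast]
      gcongr
      exact mul_le_of_le_one_right (abs_nonneg _) hu)
    ((Real.summable_pow_div_factorial |z|).comp_injective
      (mul_right_injective₀ (two_ne_zero (α := ℕ))))
    fun u _ => Real.hasSum_cos (z * u)
  refine (hasSum_kingmanKernel hs z).unique (termwise.congr_fun fun m => ?_)
  have := ascPochhammer_pos m (s + 1) (by linarith)
  have := ascPochhammer_pos m (1 / 2 : ℝ) (by norm_num)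
  have hterm (u : ℝ) : (-1) ^ m * (z * u) ^ (2 * m) / ((2 * m).factorial : ℝ) =
      (-1) ^ m * z ^ (2 * m) / ((2 * m).factorial : ℝ) * u ^ (2 * m) := by ring
  simp only [hterm]
  rw [integral_const_mul, integral_pow_two_mul_angleLaw hs,
    ← four_pow_mul_ascPochhammer_half_mul_factorial, kernelCoeff, pow_mul]
  field_simp

lemma abs_kingmanKernel_le_one (hs : -(1 / 2) ≤ s) (z : ℝ) : |kingmanKernel s z| ≤ 1 := by
  have := isProbabilityMeasure_angleLaw hs
  rw [kingmanKernel_eq_integral_cos hs, ← Real.norm_eq_abs]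
  refine (norm_integral_le_of_norm_le_const (C := 1) (.of_forall fun u => ?_)).trans (by simp)
  exact Real.abs_cos_le_one _

lemma continuous_kingmanKernel (hs : -(1 / 2) ≤ s) : Continuous (kingmanKernel s) := by
  have := isProbabilityMeasure_angleLaw hs
  rw [funext (kingmanKernel_eq_integral_cos hs)]
  refine continuous_of_dominated (bound := fun _ => 1) (fun z => ?_) (fun z => ?_)
    (integrable_const _) (.of_forall fun u => by fun_prop)
  · exact Continuous.aestronglyMeasurable (by fun_prop)
  · exact .of_forall fun u => Real.abs_cos_le_one _

lemma one_sub_kingmanKernel (hs : -(1 / 2) ≤ s) (z : ℝ) :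
    1 - kingmanKernel s z = ∫ u, (1 - Real.cos (z * u)) ∂angleLaw s := by
  have := isProbabilityMeasure_angleLaw hs
  rw [integral_sub (integrable_const _) (integrable_angleLaw_of_continuous hs (by fun_prop)),
    kingmanKernel_eq_integral_cos hs, integral_const, probReal_univ, one_smul]

lemma one_sub_kingmanKernel_two_mul_le (hs : -(1 / 2) ≤ s) (z : ℝ) :
    1 - kingmanKernel s (2 * z) ≤ 4 * (1 - kingmanKernel s z) := by
  rw [one_sub_kingmanKernel hs, one_sub_kingmanKernel hs, ← integral_const_mul]
  refine integral_mono (integrable_angleLaw_of_continuous hs (by fun_prop))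
    (integrable_angleLaw_of_continuous hs (by fun_prop)) fun u => ?_
  simp only
  rw [mul_assoc, Real.cos_two_mul]
  nlinarith [sq_nonneg (Real.cos (z * u) - 1)]

lemma one_sub_kingmanKernel_two_pow_mul_le (hs : -(1 / 2) ≤ s) (p : ℕ) (z : ℝ) :
    1 - kingmanKernel s (2 ^ p * z) ≤ 4 ^ p * (1 - kingmanKernel s z) := by
  induction p with
  | zero => simp
  | succ p ih =>
    have := one_sub_kingmanKernel_two_mul_le hs (2 ^ p * z)
    rw [pow_succ' 2, pow_succ' 4, mul_assoc, mul_assoc]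
    linarith

lemma one_sub_kingmanKernel_le (hs : -(1 / 2) ≤ s) (z : ℝ) :
    1 - kingmanKernel s z ≤ z ^ 2 / (4 * (s + 1)) := by
  rw [one_sub_kingmanKernel hs]
  calc ∫ u, (1 - Real.cos (z * u)) ∂angleLaw s ≤ ∫ u, z ^ 2 / 2 * u ^ 2 ∂angleLaw s := by
        refine integral_mono (integrable_angleLaw_of_continuous hs (by fun_prop))
          (integrable_angleLaw_of_continuous hs (by fun_prop)) fun u => ?_
        have := Real.one_sub_sq_div_two_le_cos (x := z * u)
        simp only [mul_pow] at this ⊢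
        linarith
    _ = z ^ 2 / (4 * (s + 1)) := by
        rw [integral_const_mul, integral_sq_angleLaw hs]
        field_simp
        ring

lemma abs_kingmanKernel_sub_le (hs : -(1 / 2) ≤ s) {z : ℝ} (hz : |z| ≤ 1) :
    |kingmanKernel s z - (1 - z ^ 2 / (4 * (s + 1)))| ≤ z ^ 4 := by
  have := isProbabilityMeasure_angleLaw hs
  have hdiff : kingmanKernel s z - (1 - z ^ 2 / (4 * (s + 1))) =
      ∫ u, (Real.cos (z * u) - (1 - z ^ 2 / 2 * u ^ 2)) ∂angleLaw s := by
    rw [integral_sub (integrable_angleLaw_of_continuous hs (by fun_prop))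
        (integrable_angleLaw_of_continuous hs (by fun_prop)),
      integral_sub (integrable_const _) (integrable_angleLaw_of_continuous hs (by fun_prop)),
      integral_const_mul, integral_sq_angleLaw hs, kingmanKernel_eq_integral_cos hs,
      integral_const, probReal_univ, one_smul]
    field_simp
    ring
  rw [hdiff, ← Real.norm_eq_abs]
  refine (norm_integral_le_of_norm_le_const (C := z ^ 4) ?_).trans (by simp)
  filter_upwards [ae_angleLaw_abs_le] with u hu
  have hzu : |z * u| ≤ |z| := abs_mul z u ▸ mul_le_of_le_one_right (abs_nonneg _) hu
  calc ‖Real.cos (z * u) - (1 - z ^ 2 / 2 * u ^ 2)‖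
      = |Real.cos (z * u) - (1 - (z * u) ^ 2 / 2)| := by
        rw [Real.norm_eq_abs, mul_pow, div_mul_eq_mul_div]
    _ ≤ |z * u| ^ 4 * (5 / 96) := Real.cos_bound (hzu.trans hz)
    _ ≤ |z| ^ 4 * 1 := by gcongr; norm_num
    _ = z ^ 4 := by rw [mul_one, Even.pow_abs (by decide)]

lemma integral_add_mul_pow_angleLaw (hs : -(1 / 2) ≤ s) (c d : ℝ) (n : ℕ) :
    ∫ u, (c + 2 * d * u) ^ n ∂angleLaw s = n.factorial * ∑ p ∈ Finset.range (n / 2 + 1),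
      (d ^ 2) ^ p / (p.factorial * (ascPochhammer ℝ p).eval (s + 1))
        * (c ^ (n - 2 * p) / (n - 2 * p).factorial) := by
  have binomial (u : ℝ) : (c + 2 * d * u) ^ n =
      ∑ q ∈ Finset.range (n + 1), (2 * d) ^ q * c ^ (n - q) * n.choose q * u ^ q := by
    rw [add_comm, add_pow]
    refine Finset.sum_congr rfl fun q _ => ?_
    rw [mul_pow]
    ring
  simp only [binomial]
  rw [integral_finsetSum _ fun q _ => integrable_angleLaw_of_continuous hs (by fun_prop),
    Finset.mul_sum]
  simp only [integral_const_mul]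
  symm
  refine Finset.sum_of_injOn (2 * ·) (by simp [Function.Injective.injOn, mul_right_injective₀])
    (fun p hp => ?_) (fun q hq hodd => ?_) fun p hp => ?_
  · simp only [Finset.coe_range, mem_Iio] at hp ⊢
    omega
  · rw [integral_pow_odd_angleLaw hs, mul_zero]
    rw [← Nat.not_even_iff_odd]
    rintro ⟨p, rfl⟩
    simp only [Finset.mem_range] at hq
    exact hodd ⟨p, by simp only [Finset.coe_range, mem_Iio]; omega, two_mul p⟩
  · have hpn : 2 * p ≤ n := by
      simp only [Finset.mem_range] at hp
      omega
    have := ascPochhammer_pos p (s + 1) (by linarith)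
    have := ascPochhammer_pos p (1 / 2 : ℝ) (by norm_num)
    rw [integral_pow_two_mul_angleLaw hs, Nat.cast_choose ℝ hpn,
      ← four_pow_mul_ascPochhammer_half_mul_factorial, pow_mul, mul_pow,
      show (2 : ℝ) ^ 2 = 4 by norm_num, mul_pow]
    field_simp

lemma add_pow_div_factorial (a b : ℝ) (n : ℕ) :
    (a + b) ^ n / n.factorial = ∑ ij ∈ Finset.HasAntidiagonal.antidiagonal n,
      a ^ ij.1 / ij.1.factorial * (b ^ ij.2 / ij.2.factorial) := by
  rw [(Commute.all a b).add_pow', Finset.sum_div]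
  refine Finset.sum_congr rfl fun ij hij => ?_
  rw [← Finset.HasAntidiagonal.mem_antidiagonal.1 hij, nsmul_eq_mul, Nat.cast_add_choose]
  field_simp

lemma sum_range_sum_antidiagonal {R : Type*} [AddCommMonoid R] (f : ℕ → ℕ → ℕ → R) (n : ℕ) :
    ∑ p ∈ Finset.range (n / 2 + 1), ∑ ij ∈ Finset.HasAntidiagonal.antidiagonal (n - 2 * p),
        f p ij.1 ij.2 =
      ∑ ij ∈ Finset.HasAntidiagonal.antidiagonal n, ∑ p ∈ Finset.range (min ij.1 ij.2 + 1),
        f p (ij.1 - p) (ij.2 - p) := by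
  rw [Finset.sum_sigma', Finset.sum_sigma']
  refine Finset.sum_bij' (fun q _ => ⟨(q.1 + q.2.1, q.1 + q.2.2), q.1⟩)
    (fun q _ => ⟨q.2, (q.1.1 - q.2, q.1.2 - q.2)⟩) ?_ ?_ ?_ ?_ ?_
  all_goals
    rintro ⟨⟩ hq
    simp only [Finset.mem_sigma, Finset.mem_range, Finset.HasAntidiagonal.mem_antidiagonal,
      Nat.add_sub_cancel_left, Sigma.mk.injEq, Prod.ext_iff, heq_eq_eq, and_true] at hq ⊢
  all_goals omega

/-- Both sides are the coefficient of `t ^ (2 * n)` in the product formula for `Λ_s`. -/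
lemma kernelCoeff_mul_integral_pow (hs : -(1 / 2) ≤ s) (x y : ℝ) (n : ℕ) :
    kernelCoeff s n * ∫ u, (x ^ 2 + 2 * u * x * y + y ^ 2) ^ n ∂angleLaw s =
      ∑ ij ∈ Finset.HasAntidiagonal.antidiagonal n,
        kernelCoeff s ij.1 * (x ^ 2) ^ ij.1 * (kernelCoeff s ij.2 * (y ^ 2) ^ ij.2) := by
  have ha : 0 < s + 1 := by linarith
  have hpos (m : ℕ) := ascPochhammer_pos m (s + 1) ha
  have moment : ∫ u, (x ^ 2 + 2 * u * x * y + y ^ 2) ^ n ∂angleLaw s =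
      n.factorial * ∑ ij ∈ Finset.HasAntidiagonal.antidiagonal n, (x ^ 2) ^ ij.1 * (y ^ 2) ^ ij.2
        * ∑ p ∈ Finset.range (min ij.1 ij.2 + 1), 1 / ((p.factorial : ℝ) * (ij.1 - p).factorial
          * (ij.2 - p).factorial * (ascPochhammer ℝ p).eval (s + 1)) := by
    have hside (u : ℝ) : x ^ 2 + 2 * u * x * y + y ^ 2 = x ^ 2 + y ^ 2 + 2 * (x * y) * u := by
      ring
    simp only [hside]
    rw [integral_add_mul_pow_angleLaw hs]
    simp only [add_pow_div_factorial, Finset.mul_sum]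
    rw [sum_range_sum_antidiagonal fun p i j => (n.factorial : ℝ) * (((x * y) ^ 2) ^ p
      / (p.factorial * (ascPochhammer ℝ p).eval (s + 1))
        * ((x ^ 2) ^ i / i.factorial * ((y ^ 2) ^ j / j.factorial)))]
    refine Finset.sum_congr rfl fun ij _ => Finset.sum_congr rfl fun p hp => ?_
    obtain ⟨hpi, hpj⟩ : p ≤ ij.1 ∧ p ≤ ij.2 := by
      simp only [Finset.mem_range] at hp
      omega
    rw [← pow_sub_mul_pow (x ^ 2) hpi, ← pow_sub_mul_pow (y ^ 2) hpj, mul_pow, mul_pow]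
    have := hpos p
    field_simp
  rw [moment, ← mul_assoc, Finset.mul_sum]
  refine Finset.sum_congr rfl fun ij hij => ?_
  rw [sum_inv_factorial_mul_ascPochhammer ha, ← Finset.HasAntidiagonal.mem_antidiagonal.1 hij]
  have := hpos ij.1
  have := hpos ij.2
  have := hpos (ij.1 + ij.2)
  unfold kernelCoeff
  rw [pow_add, pow_add]
  field_simp

lemma abs_sq_add_two_mul_add_sq_le {x y u : ℝ} (hx : 0 ≤ x) (hy : 0 ≤ y) (hu : |u| ≤ 1) :
    |x ^ 2 + 2 * u * x * y + y ^ 2| ≤ (x + y) ^ 2 := by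
  have hxy : 0 ≤ x * y := by positivity
  have hu' := abs_le.1 hu
  rw [abs_le]
  constructor <;> nlinarith [sq_nonneg x, sq_nonneg y]

lemma measurable_lawOfCosines (x y : ℝ≥0) : Measurable (lawOfCosines x y) := by
  unfold lawOfCosines
  fun_prop

lemma coe_lawOfCosines_sq (x y : ℝ≥0) {u : ℝ} (hu : |u| ≤ 1) :
    (lawOfCosines x y u : ℝ) ^ 2 = (x : ℝ) ^ 2 + 2 * u * x * y + (y : ℝ) ^ 2 := by
  have hnonneg : 0 ≤ (x : ℝ) ^ 2 + 2 * u * x * y + (y : ℝ) ^ 2 := by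
    have hxy : 0 ≤ (x : ℝ) * y := by positivity
    have := abs_le.1 hu
    nlinarith [sq_nonneg ((x : ℝ) - y)]
  unfold lawOfCosines
  rw [Real.coe_sqrt, Real.sq_sqrt (NNReal.coe_nonneg _), Real.coe_toNNReal _ hnonneg]

lemma isProbabilityMeasure_kingmanDirac (hs : -(1 / 2) ≤ s) (x y : ℝ≥0) :
    IsProbabilityMeasure (kingmanDirac s x y) :=
  have := isProbabilityMeasure_angleLaw hs
  Measure.isProbabilityMeasure_map (measurable_lawOfCosines x y).aemeasurable

/-- The product formula for `Λ_s`. -/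
lemma integral_kingmanKernel_kingmanDirac (hs : -(1 / 2) ≤ s) (t x y : ℝ≥0) :
    ∫ z, kingmanKernel s (t * z) ∂kingmanDirac s x y =
      kingmanKernel s (t * x) * kingmanKernel s (t * y) := by
  unfold kingmanDirac
  rw [integral_map (measurable_lawOfCosines x y).aemeasurable
    (Continuous.aestronglyMeasurable (f := fun z : ℝ≥0 => kingmanKernel s (t * z))
      ((continuous_kingmanKernel hs).comp (by fun_prop)))]
  have termwise := hasSum_integral_angleLaw hs
    (F := fun n u => ((t : ℝ) ^ 2) ^ n
      * (kernelCoeff s n * ((x : ℝ) ^ 2 + 2 * u * x * y + (y : ℝ) ^ 2) ^ n))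
    (f := fun u => kingmanKernel s (t * lawOfCosines x y u)) (fun n => by fun_prop)
    (b := fun n => ‖kernelCoeff s n * ((t : ℝ) ^ 2 * ((x : ℝ) + y) ^ 2) ^ n‖)
    (fun n u hu => by
      rw [norm_mul, Real.norm_eq_abs, Real.norm_of_nonneg (by positivity), mul_pow, abs_mul,
        abs_mul, abs_of_nonneg (by positivity), abs_pow (_ + _), mul_left_comm]
      gcongr
      exact abs_sq_add_two_mul_add_sq_le x.coe_nonneg y.coe_nonneg hu)
    (summable_norm_kernelCoeff hs _)
    fun u hu => (hasSum_kingmanKernel hs _).congr_fun fun n => by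
      rw [mul_pow, coe_lawOfCosines_sq x y hu, mul_pow]
      ring
  rw [← termwise.tsum_eq, kingmanKernel_eq_tsum hs, kingmanKernel_eq_tsum hs,
    tsum_mul_tsum_eq_tsum_sum_antidiagonal_of_summable_norm (summable_norm_kernelCoeff hs _)
      (summable_norm_kernelCoeff hs _)]
  refine tsum_congr fun n => ?_
  rw [integral_const_mul, integral_const_mul, kernelCoeff_mul_integral_pow hs, Finset.mul_sum]
  refine Finset.sum_congr rfl fun ij hij => ?_
  rw [← Finset.HasAntidiagonal.mem_antidiagonal.1 hij, mul_pow, mul_pow, mul_pow, mul_pow, pow_add]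
  ring

end Kernel

section Rayleigh

/-- The Lebesgue density of the law `σ_s` on `(0, ∞)`. -/
noncomputable def rayleighDensity (s y : ℝ) : ℝ :=
  2 * (s + 1) ^ (s + 1) / Real.Gamma (s + 1) * y ^ (2 * s + 1) * Real.exp (-(s + 1) * y ^ 2)

variable {s : ℝ}

lemma rayleighDensity_nonneg (hs : -(1 / 2) ≤ s) {y : ℝ} (hy : 0 < y) :
    0 ≤ rayleighDensity s y := by
  have ha : 0 < s + 1 := by linarith
  have := Real.Gamma_pos_of_pos ha
  unfold rayleighDensity
  positivity

lemma rayleighDensity_mul_pow {y : ℝ} (hy : 0 < y) (m : ℕ) :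
    rayleighDensity s y * y ^ (2 * m) = 2 * (s + 1) ^ (s + 1) / Real.Gamma (s + 1) *
      (y ^ (2 * s + 1 + 2 * (m : ℝ)) * Real.exp (-(s + 1) * y ^ (2 : ℝ))) := by
  rw [rayleighDensity, Real.rpow_add hy (2 * s + 1), ← Real.rpow_natCast y (2 * m),
    Real.rpow_ofNat]
  push_cast
  ring

lemma integral_rayleighLaw (hs : -(1 / 2) ≤ s) {f : ℝ≥0 → ℝ} (hf : Measurable f) :
    ∫ y, f y ∂rayleighLaw s = ∫ y in Ioi (0 : ℝ), rayleighDensity s y * f y.toNNReal := by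
  unfold rayleighLaw
  rw [integral_map measurable_real_toNNReal.aemeasurable hf.aestronglyMeasurable,
    integral_withDensity_eq_integral_toReal_smul (by fun_prop) (by simp)]
  refine setIntegral_congr_fun measurableSet_Ioi fun y hy => ?_
  exact congrArg (· * _) (ENNReal.toReal_ofReal (rayleighDensity_nonneg hs hy))

lemma integrable_rayleighLaw_iff (hs : -(1 / 2) ≤ s) {f : ℝ≥0 → ℝ} (hf : Measurable f) :
    Integrable f (rayleighLaw s) ↔
      IntegrableOn (fun y => rayleighDensity s y * f y.toNNReal) (Ioi (0 : ℝ)) := by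
  unfold rayleighLaw
  rw [integrable_map_measure hf.aestronglyMeasurable measurable_real_toNNReal.aemeasurable,
    integrable_withDensity_iff_integrable_smul' (by fun_prop) (by simp)]
  refine integrableOn_congr_fun (fun y hy => ?_) measurableSet_Ioi
  exact congrArg (· * _) (ENNReal.toReal_ofReal (rayleighDensity_nonneg hs hy))

lemma integrable_pow_rayleighLaw (hs : -(1 / 2) ≤ s) (m : ℕ) :
    Integrable (fun y : ℝ≥0 => (y : ℝ) ^ (2 * m)) (rayleighLaw s) := by
  have : (0 : ℝ) ≤ m := m.cast_nonneg
  rw [integrable_rayleighLaw_iff hs (by fun_prop)]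
  have gaussian := (integrableOn_rpow_mul_exp_neg_mul_rpow (p := 2) (s := 2 * s + 1 + 2 * m)
    (b := s + 1) (by linarith) (by norm_num) (by linarith)).const_mul
      (2 * (s + 1) ^ (s + 1) / Real.Gamma (s + 1))
  refine (integrableOn_congr_fun (fun y hy => ?_) measurableSet_Ioi).1 gaussian
  rw [Real.coe_toNNReal _ (le_of_lt hy), rayleighDensity_mul_pow hy]

lemma integral_pow_rayleighLaw (hs : -(1 / 2) ≤ s) (m : ℕ) :
    ∫ y : ℝ≥0, (y : ℝ) ^ (2 * m) ∂rayleighLaw s =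
      (ascPochhammer ℝ m).eval (s + 1) / (s + 1) ^ m := by
  have ha : 0 < s + 1 := by linarith
  have : (0 : ℝ) ≤ m := m.cast_nonneg
  have := Real.Gamma_pos_of_pos ha
  have density (y : ℝ) (hy : y ∈ Ioi (0 : ℝ)) :
      rayleighDensity s y * (y.toNNReal : ℝ) ^ (2 * m) =
        2 * (s + 1) ^ (s + 1) / Real.Gamma (s + 1) *
          (y ^ (2 * s + 1 + 2 * (m : ℝ)) * Real.exp (-(s + 1) * y ^ (2 : ℝ))) := by
    rw [Real.coe_toNNReal _ (le_of_lt hy), rayleighDensity_mul_pow hy]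
  rw [integral_rayleighLaw hs (by fun_prop), setIntegral_congr_fun measurableSet_Ioi density,
    integral_const_mul,
    integral_rpow_mul_exp_neg_mul_rpow (by norm_num) (by linarith) ha,
    show (2 * s + 1 + 2 * (m : ℝ) + 1) / 2 = s + 1 + m by ring,
    show -(2 * s + 1 + 2 * (m : ℝ) + 1) / 2 = -(s + 1 + m) by ring, Gamma_add_natCast ha,
    Real.rpow_neg ha.le, Real.rpow_add ha (s + 1) m, Real.rpow_natCast]
  have hpow : 0 < (s + 1) ^ (s + 1) := Real.rpow_pos_of_pos ha _
  generalize (s + 1) ^ (s + 1) = A at hpow ⊢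
  field_simp

lemma isProbabilityMeasure_rayleighLaw (hs : -(1 / 2) ≤ s) :
    IsProbabilityMeasure (rayleighLaw s) := by
  have hint := integrable_pow_rayleighLaw hs 0
  have htotal := integral_pow_rayleighLaw hs 0
  simp only [mul_zero, pow_zero, ascPochhammer_zero, Polynomial.eval_one, div_one] at hint htotal
  have : IsFiniteMeasure (rayleighLaw s) :=
    (integrable_const_iff_isFiniteMeasure one_ne_zero).1 hint
  rw [integral_const, smul_eq_mul, mul_one] at htotal
  exact ⟨(ENNReal.toReal_eq_one_iff _).1 htotal⟩

lemma kernelCoeff_mul_integral_pow_rayleighLaw (hs : -(1 / 2) ≤ s) (n : ℕ) (w : ℝ) :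
    kernelCoeff s n * w ^ n * ∫ y : ℝ≥0, (y : ℝ) ^ (2 * n) ∂rayleighLaw s =
      (-(w / (4 * (s + 1)))) ^ n / (n.factorial : ℝ) := by
  have := ascPochhammer_pos n (s + 1) (by linarith)
  rw [integral_pow_rayleighLaw hs, neg_pow, div_pow, mul_pow, kernelCoeff]
  field_simp

lemma integral_kingmanKernel_rayleighLaw (hs : -(1 / 2) ≤ s) (t : ℝ) :
    ∫ y : ℝ≥0, kingmanKernel s (t * y) ∂rayleighLaw s = Real.exp (-(t ^ 2 / (4 * (s + 1)))) := by
  let F : ℕ → ℝ≥0 → ℝ := fun n y => kernelCoeff s n * (t ^ 2) ^ n * (y : ℝ) ^ (2 * n)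
  have hint (n : ℕ) : Integrable (F n) (rayleighLaw s) :=
    (integrable_pow_rayleighLaw hs n).const_mul _
  have hsum : Summable fun n => ∫ y, ‖F n y‖ ∂rayleighLaw s := by
    refine (Real.summable_pow_div_factorial (-(t ^ 2 / (4 * (s + 1))))).norm.congr fun n => ?_
    have hnorm (y : ℝ≥0) : ‖F n y‖ = ‖kernelCoeff s n * (t ^ 2) ^ n‖ * (y : ℝ) ^ (2 * n) := by
      rw [norm_mul, Real.norm_of_nonneg (by positivity : 0 ≤ (y : ℝ) ^ (2 * n))]
    simp only [hnorm]
    rw [integral_const_mul, ← kernelCoeff_mul_integral_pow_rayleighLaw hs, norm_mul _ (∫ _, _ ∂_),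
      Real.norm_of_nonneg (integral_nonneg fun y : ℝ≥0 => by positivity)]
  have termwise := hasSum_integral_of_summable_integral_norm hint hsum
  have hF (y : ℝ≥0) : ∑' n, F n y = kingmanKernel s (t * y) := by
    rw [kingmanKernel_eq_tsum hs]
    simp only [F, mul_pow, pow_mul, mul_assoc]
  simp only [hF] at termwise
  rw [← termwise.tsum_eq, Real.exp_eq_exp_ℝ, NormedSpace.exp_eq_tsum_div]
  refine tsum_congr fun n => ?_
  rw [integral_const_mul, kernelCoeff_mul_integral_pow_rayleighLaw hs]

end Rayleigh

section Cone

variable {k : ℕ} {s : ℝ}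

lemma kingmanKernelPi_comm (s : ℝ) (t x : Fin k → ℝ≥0) :
    kingmanKernelPi s t x = kingmanKernelPi s x t := by
  simp only [kingmanKernelPi, mul_comm]

lemma kingmanKernelPi_zero_right (hs : -(1 / 2) ≤ s) (t : Fin k → ℝ≥0) :
    kingmanKernelPi s t 0 = 1 := by
  simp [kingmanKernelPi, kingmanKernel_zero hs]

lemma kingmanKernelPi_zero_left (hs : -(1 / 2) ≤ s) (x : Fin k → ℝ≥0) :
    kingmanKernelPi s 0 x = 1 := by
  rw [kingmanKernelPi_comm, kingmanKernelPi_zero_right hs]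

lemma kingmanKernelPi_single (hs : -(1 / 2) ≤ s) (j : Fin k) (r : ℝ≥0) (x : Fin k → ℝ≥0) :
    kingmanKernelPi s (Pi.single j r) x = kingmanKernel s (r * x j) := by
  unfold kingmanKernelPi
  rw [Finset.prod_eq_single j]
  · simp
  · intro i _ hi
    simp [hi, kingmanKernel_zero hs]
  · simp

lemma continuous_kingmanKernelPi₂ (hs : -(1 / 2) ≤ s) :
    Continuous fun p : (Fin k → ℝ≥0) × (Fin k → ℝ≥0) => kingmanKernelPi s p.1 p.2 := by
  unfold kingmanKernelPi
  exact continuous_finsetProd _ fun j _ => (continuous_kingmanKernel hs).comp (by fun_prop)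

lemma continuous_kingmanKernelPi (hs : -(1 / 2) ≤ s) (t : Fin k → ℝ≥0) :
    Continuous (kingmanKernelPi s t) :=
  (continuous_kingmanKernelPi₂ hs).comp (by fun_prop : Continuous fun x => (t, x))

lemma abs_kingmanKernelPi_le_one (hs : -(1 / 2) ≤ s) (t x : Fin k → ℝ≥0) :
    |kingmanKernelPi s t x| ≤ 1 := by
  unfold kingmanKernelPi
  rw [Finset.abs_prod]
  exact Finset.prod_le_one (fun _ _ => abs_nonneg _) fun _ _ => abs_kingmanKernel_le_one hs _

lemma one_sub_kingmanKernelPi_nonneg (hs : -(1 / 2) ≤ s) (t x : Fin k → ℝ≥0) :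
    0 ≤ 1 - kingmanKernelPi s t x :=
  sub_nonneg.2 (abs_le.1 (abs_kingmanKernelPi_le_one hs t x)).2

lemma one_sub_prod_le_sum {ι : Type*} (S : Finset ι) (f : ι → ℝ) (hf : ∀ i, |f i| ≤ 1) :
    1 - ∏ i ∈ S, f i ≤ ∑ i ∈ S, (1 - f i) := by
  classical
  induction S using Finset.induction_on with
  | empty => simp
  | insert a S ha ih =>
    rw [Finset.prod_insert ha, Finset.sum_insert ha]
    have hprod : |∏ i ∈ S, f i| ≤ 1 := by
      rw [Finset.abs_prod]
      exact Finset.prod_le_one (fun _ _ => abs_nonneg _) fun i _ => hf i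
    nlinarith [abs_le.1 (hf a), abs_le.1 hprod]

lemma one_sub_kingmanKernelPi_le_sum (hs : -(1 / 2) ≤ s) (t x : Fin k → ℝ≥0) :
    1 - kingmanKernelPi s t x ≤ ∑ j, (1 - kingmanKernel s (t j * x j)) :=
  one_sub_prod_le_sum _ _ fun _ => abs_kingmanKernel_le_one hs _

lemma integrable_kingmanKernelPi (hs : -(1 / 2) ≤ s) (N : Measure (Fin k → ℝ≥0))
    [IsFiniteMeasure N] (t : Fin k → ℝ≥0) : Integrable (kingmanKernelPi s t) N :=
  Integrable.of_bound (continuous_kingmanKernelPi hs t).aestronglyMeasurable 1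
    (.of_forall fun x => abs_kingmanKernelPi_le_one hs t x)

lemma integral_one_sub_kingmanKernelPi (hs : -(1 / 2) ≤ s) (N : Measure (Fin k → ℝ≥0))
    [IsFiniteMeasure N] (t : Fin k → ℝ≥0) :
    ∫ x, (1 - kingmanKernelPi s t x) ∂N = N.real univ - radCharFun s N t := by
  rw [integral_sub (integrable_const _) (integrable_kingmanKernelPi hs N t)]
  simp [radCharFun]

lemma radCharFun_zero (hs : -(1 / 2) ≤ s) (N : Measure (Fin k → ℝ≥0)) :
    radCharFun s N 0 = N.real univ := by
  unfold radCharFun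
  simp [kingmanKernelPi_zero_left hs]

lemma continuous_radCharFun (hs : -(1 / 2) ≤ s) (N : Measure (Fin k → ℝ≥0))
    [IsFiniteMeasure N] : Continuous (radCharFun s N) := by
  unfold radCharFun
  refine continuous_of_dominated (bound := fun _ => 1) (fun t => ?_) (fun t => ?_)
    (integrable_const _) (.of_forall fun x => ?_)
  · exact (continuous_kingmanKernelPi hs t).aestronglyMeasurable
  · exact .of_forall fun x => abs_kingmanKernelPi_le_one hs t x
  · exact (continuous_kingmanKernelPi₂ hs).comp (by fun_prop : Continuous fun t => (t, x))

lemma isProbabilityMeasure_kingmanDiracPi (hs : -(1 / 2) ≤ s) (x y : Fin k → ℝ≥0) :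
    IsProbabilityMeasure (kingmanDiracPi s x y) :=
  have := fun j => isProbabilityMeasure_kingmanDirac hs (x j) (y j)
  inferInstanceAs (IsProbabilityMeasure (Measure.pi fun j => kingmanDirac s (x j) (y j)))

lemma radCharFun_kingmanDiracPi (hs : -(1 / 2) ≤ s) (t x y : Fin k → ℝ≥0) :
    radCharFun s (kingmanDiracPi s x y) t = kingmanKernelPi s t x * kingmanKernelPi s t y := by
  have := fun j => isProbabilityMeasure_kingmanDirac hs (x j) (y j)
  unfold radCharFun kingmanDiracPi kingmanKernelPi
  rw [integral_fintype_prod_eq_prod (fun j (z : ℝ≥0) => kingmanKernel s (t j * z)),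
    ← Finset.prod_mul_distrib]
  exact Finset.prod_congr rfl fun j _ => integral_kingmanKernel_kingmanDirac hs _ _ _

lemma kingmanConv_univ (hs : -(1 / 2) ≤ s) (G₁ G₂ : Measure (Fin k → ℝ≥0)) [SFinite G₂] :
    kingmanConv s G₁ G₂ univ = G₁ univ * G₂ univ := by
  have := fun x y : Fin k → ℝ≥0 => isProbabilityMeasure_kingmanDiracPi hs x y
  unfold kingmanConv
  rw [Measure.bind_apply MeasurableSet.univ (measurable_kingmanDiracPi hs).aemeasurable]
  simp [← Measure.prod_prod]

lemma isFiniteMeasure_kingmanConv (hs : -(1 / 2) ≤ s) (G₁ G₂ : Measure (Fin k → ℝ≥0))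
    [IsFiniteMeasure G₁] [IsFiniteMeasure G₂] : IsFiniteMeasure (kingmanConv s G₁ G₂) := by
  constructor
  rw [kingmanConv_univ hs]
  exact ENNReal.mul_lt_top (measure_lt_top _ _) (measure_lt_top _ _)

lemma isProbabilityMeasure_kingmanConv (hs : -(1 / 2) ≤ s) (G₁ G₂ : Measure (Fin k → ℝ≥0))
    [IsProbabilityMeasure G₁] [IsProbabilityMeasure G₂] :
    IsProbabilityMeasure (kingmanConv s G₁ G₂) := by
  constructor
  simp [kingmanConv_univ hs]

lemma integral_bind {α β E : Type*} [MeasurableSpace α] [MeasurableSpace β]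
    [NormedAddCommGroup E] [NormedSpace ℝ E] {m : Measure α} {κ : α → Measure β}
    (hκ : Measurable κ) {f : β → E} (hf : Integrable f (m.bind κ)) :
    ∫ y, f y ∂m.bind κ = ∫ a, ∫ y, f y ∂κ a ∂m :=
  ProbabilityTheory.Kernel.integral_comp (η := ⟨κ, hκ⟩) (κ := .const Unit m) (a := ()) hf

lemma radCharFun_kingmanConv (hs : -(1 / 2) ≤ s) (G₁ G₂ : Measure (Fin k → ℝ≥0))
    [IsFiniteMeasure G₁] [IsFiniteMeasure G₂] (t : Fin k → ℝ≥0) :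
    radCharFun s (kingmanConv s G₁ G₂) t = radCharFun s G₁ t * radCharFun s G₂ t := by
  have := isFiniteMeasure_kingmanConv hs G₁ G₂
  calc radCharFun s (kingmanConv s G₁ G₂) t
      = ∫ p, radCharFun s (kingmanDiracPi s p.1 p.2) t ∂G₁.prod G₂ :=
        integral_bind (measurable_kingmanDiracPi hs)
          (integrable_kingmanKernelPi hs (kingmanConv s G₁ G₂) t)
    _ = radCharFun s G₁ t * radCharFun s G₂ t := by
        simp only [radCharFun_kingmanDiracPi hs]
        exact integral_prod_mul _ _

lemma isFiniteMeasure_kingmanPow (hs : -(1 / 2) ≤ s) (G : Measure (Fin k → ℝ≥0))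
    [IsFiniteMeasure G] (n : ℕ) : IsFiniteMeasure (kingmanPow s G n) := by
  induction n with
  | zero => exact inferInstanceAs (IsFiniteMeasure (Measure.dirac 0))
  | succ n ih => exact isFiniteMeasure_kingmanConv hs _ _

lemma kingmanPow_univ (hs : -(1 / 2) ≤ s) (G : Measure (Fin k → ℝ≥0))
    [IsFiniteMeasure G] (n : ℕ) : kingmanPow s G n univ = G univ ^ n := by
  induction n with
  | zero => simp [kingmanPow]
  | succ n ih =>
    have := isFiniteMeasure_kingmanPow hs G n
    rw [kingmanPow, kingmanConv_univ hs, ih, pow_succ]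

lemma isProbabilityMeasure_kingmanPow (hs : -(1 / 2) ≤ s) (G : Measure (Fin k → ℝ≥0))
    [IsProbabilityMeasure G] (n : ℕ) : IsProbabilityMeasure (kingmanPow s G n) :=
  ⟨by simp [kingmanPow_univ hs]⟩

lemma radCharFun_kingmanPow (hs : -(1 / 2) ≤ s) (G : Measure (Fin k → ℝ≥0))
    [IsFiniteMeasure G] (n : ℕ) (t : Fin k → ℝ≥0) :
    radCharFun s (kingmanPow s G n) t = radCharFun s G t ^ n := by
  induction n with
  | zero =>
    simp only [kingmanPow, radCharFun, pow_zero]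
    rw [integral_dirac, kingmanKernelPi_zero_right hs]
  | succ n ih =>
    have := isFiniteMeasure_kingmanPow hs G n
    rw [kingmanPow, radCharFun_kingmanConv hs, ih, pow_succ]

end Cone

section Gaussian

variable {k : ℕ} {s : ℝ}

/-- The law `T_{l_1} σ_s × ⋯ × T_{l_k} σ_s`. -/
noncomputable def rayleighPi (s : ℝ) (l : Fin k → ℝ≥0) : Measure (Fin k → ℝ≥0) :=
  Measure.pi fun j => (rayleighLaw s).map fun x => l j * x

lemma isProbabilityMeasure_map_rayleighLaw (hs : -(1 / 2) ≤ s) (c : ℝ≥0) :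
    IsProbabilityMeasure ((rayleighLaw s).map fun x => c * x) :=
  have := isProbabilityMeasure_rayleighLaw hs
  Measure.isProbabilityMeasure_map (by fun_prop)

lemma isProbabilityMeasure_rayleighPi (hs : -(1 / 2) ≤ s) (l : Fin k → ℝ≥0) :
    IsProbabilityMeasure (rayleighPi s l) :=
  have := fun j => isProbabilityMeasure_map_rayleighLaw hs (l j)
  inferInstanceAs (IsProbabilityMeasure (Measure.pi _))

lemma radCharFun_rayleighPi (hs : -(1 / 2) ≤ s) (l t : Fin k → ℝ≥0) :
    radCharFun s (rayleighPi s l) t =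
      Real.exp (-∑ j, (l j : ℝ) ^ 2 * (t j : ℝ) ^ 2 / (4 * (s + 1))) := by
  have := fun j => isProbabilityMeasure_map_rayleighLaw hs (l j)
  unfold radCharFun rayleighPi kingmanKernelPi
  rw [integral_fintype_prod_eq_prod (fun j (z : ℝ≥0) => kingmanKernel s (t j * z)),
    ← Finset.sum_neg_distrib, Real.exp_sum]
  refine Finset.prod_congr rfl fun j _ => ?_
  rw [integral_map (by fun_prop) (Continuous.aestronglyMeasurable
    (f := fun z : ℝ≥0 => kingmanKernel s (t j * z))
      ((continuous_kingmanKernel hs).comp (by fun_prop)))]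
  simp only [NNReal.coe_mul, ← mul_assoc]
  rw [integral_kingmanKernel_rayleighLaw hs (t j * l j), mul_pow, mul_comm (_ ^ 2)]

/-- The Gaussian `x ↦ exp (-∑ j, a j * x j ^ 2)` on the cone. These functions play the role of the
characters in determining a measure, since they are stable under multiplication. -/
noncomputable def gaussFun (a x : Fin k → ℝ≥0) : ℝ := Real.exp (-∑ j, (a j : ℝ) * (x j : ℝ) ^ 2)

lemma continuous_gaussFun (a : Fin k → ℝ≥0) : Continuous (gaussFun a) := by
  unfold gaussFun
  fun_prop

lemma gaussFun_pos (a x : Fin k → ℝ≥0) : 0 < gaussFun a x := Real.exp_pos _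

lemma gaussFun_le_one (a x : Fin k → ℝ≥0) : gaussFun a x ≤ 1 := by
  unfold gaussFun
  rw [Real.exp_le_one_iff, neg_nonpos]
  positivity

lemma norm_gaussFun_le_one (a x : Fin k → ℝ≥0) : ‖gaussFun a x‖ ≤ 1 :=
  (Real.norm_of_nonneg (gaussFun_pos a x).le).trans_le (gaussFun_le_one a x)

lemma gaussFun_zero (x : Fin k → ℝ≥0) : gaussFun 0 x = 1 := by
  simp [gaussFun]

lemma gaussFun_add (a b x : Fin k → ℝ≥0) :
    gaussFun (a + b) x = gaussFun a x * gaussFun b x := by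
  unfold gaussFun
  rw [← Real.exp_add, ← neg_add, ← Finset.sum_add_distrib]
  simp only [Pi.add_apply, NNReal.coe_add, add_mul]

lemma gaussFun_single (j : Fin k) (x : Fin k → ℝ≥0) :
    gaussFun (Pi.single j 1) x = Real.exp (-(x j : ℝ) ^ 2) := by
  unfold gaussFun
  rw [Finset.sum_eq_single j (fun i _ hi => by simp [hi]) (by simp), Pi.single_eq_same,
    NNReal.coe_one, one_mul]

lemma integrable_gaussFun (N : Measure (Fin k → ℝ≥0)) [IsFiniteMeasure N] (a : Fin k → ℝ≥0) :
    Integrable (gaussFun a) N :=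
  Integrable.of_bound (continuous_gaussFun a).aestronglyMeasurable 1
    (.of_forall (norm_gaussFun_le_one a))

/-- The law whose radial characteristic function is `gaussFun a`. -/
noncomputable def gaussMixing (s : ℝ) (a : Fin k → ℝ≥0) : Measure (Fin k → ℝ≥0) :=
  rayleighPi s fun j => NNReal.sqrt (a j * (4 * (s + 1)).toNNReal)

lemma isProbabilityMeasure_gaussMixing (hs : -(1 / 2) ≤ s) (a : Fin k → ℝ≥0) :
    IsProbabilityMeasure (gaussMixing s a) :=
  isProbabilityMeasure_rayleighPi hs _

lemma radCharFun_gaussMixing (hs : -(1 / 2) ≤ s) (a t : Fin k → ℝ≥0) :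
    radCharFun s (gaussMixing s a) t = gaussFun a t := by
  have ha : 0 < s + 1 := by linarith
  rw [gaussMixing, radCharFun_rayleighPi hs, gaussFun]
  congr 2
  refine Finset.sum_congr rfl fun j _ => ?_
  rw [Real.coe_sqrt, Real.sq_sqrt (NNReal.coe_nonneg _), NNReal.coe_mul,
    Real.coe_toNNReal _ (by positivity)]
  field_simp

lemma integral_radCharFun_gaussMixing (hs : -(1 / 2) ≤ s) (N : Measure (Fin k → ℝ≥0))
    [IsFiniteMeasure N] (a : Fin k → ℝ≥0) :
    ∫ t, radCharFun s N t ∂gaussMixing s a = ∫ x, gaussFun a x ∂N := by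
  have := isProbabilityMeasure_gaussMixing hs a
  unfold radCharFun
  rw [integral_integral_swap]
  · refine integral_congr_ae (.of_forall fun x => ?_)
    simp only [kingmanKernelPi_comm s _ x]
    exact radCharFun_gaussMixing hs a x
  · exact Integrable.of_bound (continuous_kingmanKernelPi₂ hs).aestronglyMeasurable 1
      (.of_forall fun p => abs_kingmanKernelPi_le_one hs p.1 p.2)

open BoundedContinuousFunction in
theorem ext_of_forall_mem_submonoid_integral_eq {E : Type*} [TopologicalSpace E] [PolishSpace E]
    [MeasurableSpace E] [BorelSpace E] {P Q : Measure E} [IsFiniteMeasure P] [IsFiniteMeasure Q]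
    (S : Submonoid (E →ᵇ ℝ)) (hsep : ∀ ⦃x y⦄, x ≠ y → ∃ f ∈ S, f x ≠ f y)
    (h : ∀ f ∈ S, ∫ x, f x ∂P = ∫ x, f x ∂Q) : P = Q := by
  let A : StarSubalgebra ℝ (E →ᵇ ℝ) :=
    { Algebra.adjoin ℝ (S : Set (E →ᵇ ℝ)) with
      star_mem' := fun {f} hf => by
        rwa [show star f = f from BoundedContinuousFunction.ext fun x => star_trivial (f x)] }
  have span_eq : Subalgebra.toSubmodule (Algebra.adjoin ℝ (S : Set (E →ᵇ ℝ))) =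
      Submodule.span ℝ (S : Set (E →ᵇ ℝ)) := by
    rw [Algebra.adjoin_eq_span, Submonoid.closure_eq]
  refine ext_of_forall_mem_subalgebra_integral_eq_of_polish (A := A) (fun x y hxy => ?_) ?_
  · obtain ⟨f, hfS, hf⟩ := hsep hxy
    exact ⟨f, ⟨f, ⟨f, Algebra.subset_adjoin hfS, rfl⟩, rfl⟩, hf⟩
  · intro g hg
    replace hg : g ∈ Submodule.span ℝ (S : Set (E →ᵇ ℝ)) := span_eq ▸ hg
    induction hg using Submodule.span_induction with
    | mem f hf => exact h f hf
    | zero => simp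
    | add f g _ _ hf hg =>
      simp only [coe_add, Pi.add_apply]
      rw [integral_add (f.integrable _) (g.integrable _),
        integral_add (f.integrable _) (g.integrable _), hf, hg]
    | smul c f _ hf =>
      simp only [coe_smul]
      rw [integral_smul, integral_smul, hf]

/-- `gaussFun a` bundled as a bounded continuous function. -/
noncomputable def gaussBCF (a : Fin k → ℝ≥0) : BoundedContinuousFunction (Fin k → ℝ≥0) ℝ :=
  .ofNormedAddCommGroup (gaussFun a) (continuous_gaussFun a) 1 (norm_gaussFun_le_one a)

theorem ext_of_integral_gaussFun {N N' : Measure (Fin k → ℝ≥0)} [IsFiniteMeasure N]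
    [IsFiniteMeasure N'] (h : ∀ a, ∫ x, gaussFun a x ∂N = ∫ x, gaussFun a x ∂N') : N = N' := by
  let S : Submonoid (BoundedContinuousFunction (Fin k → ℝ≥0) ℝ) :=
    { carrier := range gaussBCF
      one_mem' := ⟨0, BoundedContinuousFunction.ext gaussFun_zero⟩
      mul_mem' := by
        rintro _ _ ⟨a, rfl⟩ ⟨b, rfl⟩
        exact ⟨a + b, BoundedContinuousFunction.ext (gaussFun_add a b)⟩ }
  refine ext_of_forall_mem_submonoid_integral_eq S (fun x y hxy => ?_) ?_
  · obtain ⟨j, hj⟩ := Function.ne_iff.1 hxy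
    refine ⟨gaussBCF (Pi.single j 1), ⟨_, rfl⟩, fun (heq : gaussFun _ x = gaussFun _ y) => hj ?_⟩
    rw [gaussFun_single, gaussFun_single, Real.exp_eq_exp, neg_inj,
      sq_eq_sq₀ (NNReal.coe_nonneg _) (NNReal.coe_nonneg _), NNReal.coe_inj] at heq
    exact heq
  · rintro _ ⟨a, rfl⟩
    exact h a

theorem ext_of_radCharFun (hs : -(1 / 2) ≤ s) {N N' : Measure (Fin k → ℝ≥0)} [IsFiniteMeasure N]
    [IsFiniteMeasure N'] (h : ∀ t, radCharFun s N t = radCharFun s N' t) : N = N' := by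
  refine ext_of_integral_gaussFun fun a => ?_
  rw [← integral_radCharFun_gaussMixing hs, ← integral_radCharFun_gaussMixing hs, funext h]

end Gaussian

section LevyIntegrand

variable {k : ℕ} {s : ℝ}

lemma coneNormSq_nonneg (x : Fin k → ℝ≥0) : 0 ≤ coneNormSq x := by
  unfold coneNormSq
  positivity

lemma continuous_coneNormSq : Continuous (coneNormSq (k := k)) := by
  unfold coneNormSq
  fun_prop

lemma measurable_coneNormSq : Measurable (coneNormSq (k := k)) :=
  continuous_coneNormSq.measurable

lemma coneNormSq_zero : coneNormSq (0 : Fin k → ℝ≥0) = 0 := by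
  simp [coneNormSq]

lemma tendsto_coneNormSq : Tendsto (coneNormSq (k := k)) (𝓝 0) (𝓝 0) :=
  continuous_coneNormSq.tendsto' 0 0 coneNormSq_zero

lemma sq_le_coneNormSq (x : Fin k → ℝ≥0) (j : Fin k) : (x j : ℝ) ^ 2 ≤ coneNormSq x :=
  Finset.single_le_sum (f := fun j => (x j : ℝ) ^ 2) (fun _ _ => sq_nonneg _) (Finset.mem_univ j)

lemma coneNormSq_pos {x : Fin k → ℝ≥0} (hx : x ≠ 0) : 0 < coneNormSq x := by
  obtain ⟨j, hj⟩ := Function.ne_iff.1 hx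
  have : 0 < x j := pos_iff_ne_zero.2 hj
  exact lt_of_lt_of_le (by positivity) (sq_le_coneNormSq x j)

lemma one_add_coneNormSq_div_nonneg (x : Fin k → ℝ≥0) :
    0 ≤ (1 + coneNormSq x) / coneNormSq x := by
  have := coneNormSq_nonneg x
  positivity

lemma one_sub_kingmanKernelPi_le (hs : -(1 / 2) ≤ s) (t x : Fin k → ℝ≥0) :
    1 - kingmanKernelPi s t x ≤ coneNormSq t * coneNormSq x := by
  refine (one_sub_kingmanKernelPi_le_sum hs t x).trans ?_
  rw [coneNormSq, Finset.sum_mul]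
  refine Finset.sum_le_sum fun j _ => ?_
  calc 1 - kingmanKernel s (t j * x j) ≤ ((t j : ℝ) * x j) ^ 2 / (4 * (s + 1)) :=
        one_sub_kingmanKernel_le hs _
    _ ≤ ((t j : ℝ) * x j) ^ 2 := div_le_self (sq_nonneg _) (by linarith)
    _ = (t j : ℝ) ^ 2 * (x j : ℝ) ^ 2 := mul_pow _ _ _
    _ ≤ (t j : ℝ) ^ 2 * coneNormSq x := by
        gcongr
        exact sq_le_coneNormSq x j

lemma mul_one_add_div_le {b A n : ℝ} (hn : 0 ≤ n) (hA : 0 ≤ A) (hb : b ≤ 2) (hbA : b ≤ A * n) :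
    b * ((1 + n) / n) ≤ 2 + A := by
  rcases hn.eq_or_lt with rfl | hn
  · simp only [div_zero, mul_zero]
    linarith
  · rw [mul_div_assoc', div_le_iff₀ hn]
    nlinarith

lemma levyIntegrand_nonneg (hs : -(1 / 2) ≤ s) (t x : Fin k → ℝ≥0) : 0 ≤ levyIntegrand s t x :=
  mul_nonneg (one_sub_kingmanKernelPi_nonneg hs t x) (one_add_coneNormSq_div_nonneg x)

lemma levyIntegrand_le (hs : -(1 / 2) ≤ s) (t x : Fin k → ℝ≥0) :
    levyIntegrand s t x ≤ 2 + coneNormSq t :=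
  mul_one_add_div_le (coneNormSq_nonneg x) (coneNormSq_nonneg t)
    (by linarith [(abs_le.1 (abs_kingmanKernelPi_le_one hs t x)).1])
    (one_sub_kingmanKernelPi_le hs t x)

lemma norm_levyIntegrand_le (hs : -(1 / 2) ≤ s) (t x : Fin k → ℝ≥0) :
    ‖levyIntegrand s t x‖ ≤ 2 + coneNormSq t :=
  (Real.norm_of_nonneg (levyIntegrand_nonneg hs t x)).trans_le (levyIntegrand_le hs t x)

lemma measurable_levyIntegrand₂ (hs : -(1 / 2) ≤ s) :
    Measurable fun p : (Fin k → ℝ≥0) × (Fin k → ℝ≥0) => levyIntegrand s p.1 p.2 := by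
  have := (continuous_kingmanKernelPi₂ (k := k) hs).measurable
  have := measurable_coneNormSq (k := k)
  unfold levyIntegrand
  fun_prop

lemma measurable_levyIntegrand (hs : -(1 / 2) ≤ s) (t : Fin k → ℝ≥0) :
    Measurable (levyIntegrand s t) := by
  have := (continuous_kingmanKernelPi (k := k) hs t).measurable
  have := measurable_coneNormSq (k := k)
  unfold levyIntegrand
  fun_prop

lemma integrable_levyIntegrand (hs : -(1 / 2) ≤ s) (M : Measure (Fin k → ℝ≥0)) [IsFiniteMeasure M]
    (t : Fin k → ℝ≥0) : Integrable (levyIntegrand s t) M :=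
  .of_bound (measurable_levyIntegrand hs t).aestronglyMeasurable _
    (.of_forall (norm_levyIntegrand_le hs t))

open Asymptotics in
lemma isLittleO_prod_sub_one_sub_sum {α ι : Type*} {l : Filter α} {g : α → ℝ}
    (hg : Tendsto g l (𝓝 0)) {f q : ι → α → ℝ} (hq : ∀ i, q i =O[l] g)
    (hf : ∀ i, (fun x => f i x - (1 - q i x)) =o[l] g) (S : Finset ι) :
    (fun x => ∏ i ∈ S, f i x - (1 - ∑ i ∈ S, q i x)) =o[l] g := by
  classical
  have tendsto_sum (S : Finset ι) : Tendsto (fun x => ∑ i ∈ S, q i x) l (𝓝 0) := by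
    simpa using tendsto_finsetSum S fun i _ => (hq i).trans_tendsto hg
  induction S using Finset.induction_on with
  | empty => simp
  | insert a S haS ih =>
    have split : (fun x => ∏ i ∈ insert a S, f i x - (1 - ∑ i ∈ insert a S, q i x)) = fun x =>
        (f a x - (1 - q a x)) * ∏ i ∈ S, f i x +
        (1 - q a x) * (∏ i ∈ S, f i x - (1 - ∑ i ∈ S, q i x)) +
        q a x * ∑ i ∈ S, q i x := by
      funext x
      rw [Finset.prod_insert haS, Finset.sum_insert haS]
      ring
    have hprod : (fun x => ∏ i ∈ S, f i x) =O[l] fun _ => (1 : ℝ) := by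
      have := (ih.trans_tendsto hg).add ((tendsto_const_nhds (x := (1 : ℝ))).sub (tendsto_sum S))
      exact (this.congr fun x => sub_add_cancel _ _).isBigO_one ℝ
    have hone_sub : (fun x => 1 - q a x) =O[l] fun _ => (1 : ℝ) :=
      (tendsto_const_nhds.sub ((hq a).trans_tendsto hg)).isBigO_one ℝ
    rw [split]
    refine (IsLittleO.add ?_ ?_).add ?_
    · simpa using (hf a).mul_isBigO hprod
    · simpa using hone_sub.mul_isLittleO ih
    · simpa using (hq a).mul_isLittleO ((isLittleO_one_iff ℝ).2 (tendsto_sum S))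

lemma isBigO_sq_mul_sq_div_coneNormSq (s : ℝ) (t : Fin k → ℝ≥0) (j : Fin k) :
    (fun x : Fin k → ℝ≥0 => (t j : ℝ) ^ 2 * (x j : ℝ) ^ 2 / (4 * (s + 1))) =O[𝓝 0] coneNormSq := by
  have : (fun x : Fin k → ℝ≥0 => (x j : ℝ) ^ 2) =O[𝓝 0] coneNormSq :=
    .of_norm_le fun x => by
      rw [Real.norm_of_nonneg (sq_nonneg _)]
      exact sq_le_coneNormSq x j
  exact (this.const_mul_left ((t j : ℝ) ^ 2 / (4 * (s + 1)))).congr_left fun x => by ring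

lemma kingmanKernel_mul_sub_isLittleO (hs : -(1 / 2) ≤ s) (t : Fin k → ℝ≥0) (j : Fin k) :
    (fun x : Fin k → ℝ≥0 => kingmanKernel s (t j * x j) -
      (1 - (t j : ℝ) ^ 2 * (x j : ℝ) ^ 2 / (4 * (s + 1)))) =o[𝓝 0] coneNormSq := by
  have quartic : (fun x : Fin k → ℝ≥0 => kingmanKernel s (t j * x j) -
      (1 - (t j : ℝ) ^ 2 * (x j : ℝ) ^ 2 / (4 * (s + 1)))) =O[𝓝 0] fun x => coneNormSq x ^ 2 := by
    refine .of_bound ((t j : ℝ) ^ 4) ?_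
    have tendsto_arg : Tendsto (fun x : Fin k → ℝ≥0 => |(t j : ℝ) * x j|) (𝓝 0) (𝓝 0) :=
      Continuous.tendsto' (by fun_prop) _ _ (by simp)
    filter_upwards [tendsto_arg.eventually_lt_const one_pos] with x hx
    rw [Real.norm_of_nonneg (sq_nonneg (coneNormSq x)), Real.norm_eq_abs, ← mul_pow]
    refine (abs_kingmanKernel_sub_le hs hx.le).trans ?_
    calc ((t j : ℝ) * x j) ^ 4 = (t j : ℝ) ^ 4 * ((x j : ℝ) ^ 2) ^ 2 := by ring
      _ ≤ (t j : ℝ) ^ 4 * coneNormSq x ^ 2 := by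
          gcongr
          exact sq_le_coneNormSq x j
  refine quartic.trans_isLittleO ?_
  simpa only [pow_two, mul_one] using (Asymptotics.isBigO_refl coneNormSq _).mul_isLittleO
    ((Asymptotics.isLittleO_one_iff ℝ).2 (tendsto_coneNormSq (k := k)))

lemma kingmanKernelPi_sub_isLittleO (hs : -(1 / 2) ≤ s) (t : Fin k → ℝ≥0) :
    (fun x : Fin k → ℝ≥0 => kingmanKernelPi s t x -
      (1 - ∑ j, (t j : ℝ) ^ 2 * (x j : ℝ) ^ 2 / (4 * (s + 1)))) =o[𝓝 0] coneNormSq :=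
  isLittleO_prod_sub_one_sub_sum tendsto_coneNormSq (isBigO_sq_mul_sq_div_coneNormSq s t)
    (kingmanKernel_mul_sub_isLittleO hs t) Finset.univ

lemma eventually_le_one_sub_kingmanKernelPi_one (hs : -(1 / 2) ≤ s) :
    ∀ᶠ x : Fin k → ℝ≥0 in 𝓝 0,
      1 / (8 * (s + 1)) * coneNormSq x ≤ 1 - kingmanKernelPi s 1 x := by
  have ha : 0 < s + 1 := by linarith
  filter_upwards [(kingmanKernelPi_sub_isLittleO (k := k) hs 1).def
    (by positivity : 0 < 1 / (8 * (s + 1)))] with x hx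
  have hsum : ∑ j, ((1 : Fin k → ℝ≥0) j : ℝ) ^ 2 * (x j : ℝ) ^ 2 / (4 * (s + 1)) =
      2 * (1 / (8 * (s + 1)) * coneNormSq x) := by
    rw [← Finset.sum_div, coneNormSq]
    simp only [Pi.one_apply, NNReal.coe_one, one_pow, one_mul]
    field_simp
    ring
  rw [hsum, Real.norm_of_nonneg (coneNormSq_nonneg x), Real.norm_eq_abs] at hx
  linarith [(abs_le.1 hx).2]

lemma eventually_le_levyIntegrand_one (hs : -(1 / 2) ≤ s) :
    ∀ᶠ x : Fin k → ℝ≥0 in 𝓝 0, x ≠ 0 → 1 / (8 * (s + 1)) ≤ levyIntegrand s 1 x := by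
  filter_upwards [eventually_le_one_sub_kingmanKernelPi_one hs] with x hx hx0
  rw [levyIntegrand, mul_div_assoc', le_div_iff₀ (coneNormSq_pos hx0)]
  have := mul_nonneg (one_sub_kingmanKernelPi_nonneg hs 1 x) (coneNormSq_nonneg x)
  linarith

lemma IsLevyMeasure.isFiniteMeasure (hs : -(1 / 2) ≤ s) {M : Measure (Fin k → ℝ≥0)}
    (hM : IsLevyMeasure M) (hint : Integrable (levyIntegrand s 1) M) : IsFiniteMeasure M := by
  have ha : 0 < s + 1 := by linarith
  have cover : (univ : Set (Fin k → ℝ≥0)) ⊆ {0} ∪ {x | 1 / (8 * (s + 1)) ≤ levyIntegrand s 1 x} ∪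
      {x | x ≠ 0 → 1 / (8 * (s + 1)) ≤ levyIntegrand s 1 x}ᶜ := fun x _ => by
    simp only [mem_union, mem_singleton_iff, mem_ofPred_eq, mem_compl_iff]
    tauto
  refine ⟨(measure_mono cover).trans_lt (measure_union_lt_top (measure_union_lt_top ?_ ?_)
    (hM.finite_compl _ (eventually_le_levyIntegrand_one hs)))⟩
  · simp [hM.zero]
  · exact hint.measure_ge_lt_top (by positivity)

lemma HasLevyRep.isFiniteMeasure (hs : -(1 / 2) ≤ s) {μ M : Measure (Fin k → ℝ≥0)}
    {l : Fin k → ℝ≥0} (h : HasLevyRep s μ M l) : IsFiniteMeasure M :=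
  h.levy.isFiniteMeasure hs (h.integrable 1)

end LevyIntegrand

section Uniqueness

variable {k : ℕ} {s : ℝ}

lemma integrable_sq_rayleighPi (hs : -(1 / 2) ≤ s) (l : Fin k → ℝ≥0) (j : Fin k) :
    Integrable (fun t : Fin k → ℝ≥0 => (t j : ℝ) ^ 2) (rayleighPi s l) := by
  have := fun j => isProbabilityMeasure_map_rayleighLaw hs (l j)
  have hsq : AEStronglyMeasurable (fun z : ℝ≥0 => (z : ℝ) ^ 2)
      ((rayleighLaw s).map fun x => l j * x) := by fun_prop
  refine ((measurePreserving_eval (fun j => (rayleighLaw s).map fun x => l j * x) j).integrable_comp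
    hsq).2 ?_
  rw [integrable_map_measure hsq (by fun_prop)]
  refine ((integrable_pow_rayleighLaw hs 1).const_mul ((l j : ℝ) ^ 2)).congr
    (.of_forall fun z => ?_)
  simp [mul_pow]

lemma integral_sq_rayleighPi (hs : -(1 / 2) ≤ s) (l : Fin k → ℝ≥0) (j : Fin k) :
    ∫ t, (t j : ℝ) ^ 2 ∂rayleighPi s l = (l j : ℝ) ^ 2 := by
  have := fun j => isProbabilityMeasure_map_rayleighLaw hs (l j)
  have hmp := measurePreserving_eval (fun j => (rayleighLaw s).map fun x => l j * x) j
  have marginal : ∫ t, (t j : ℝ) ^ 2 ∂rayleighPi s l =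
      ∫ z, (z : ℝ) ^ 2 ∂((rayleighLaw s).map fun x => l j * x) := by
    rw [← hmp.map_eq, integral_map (measurable_pi_apply j).aemeasurable (by fun_prop)]
    rfl
  rw [marginal, integral_map (by fun_prop) (by fun_prop)]
  have moment := integral_pow_rayleighLaw hs 1
  rw [mul_one, pow_one, ascPochhammer_one, Polynomial.eval_X, div_self (by linarith)] at moment
  simp only [NNReal.coe_mul, mul_pow]
  rw [integral_const_mul, moment, mul_one]

lemma coe_sqrt_mul_toNNReal_sq (a : ℝ≥0) {c : ℝ} (hc : 0 ≤ c) :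
    (NNReal.sqrt (a * c.toNNReal) : ℝ) ^ 2 = c * a := by
  rw [Real.coe_sqrt, Real.sq_sqrt (NNReal.coe_nonneg _), NNReal.coe_mul, Real.coe_toNNReal _ hc,
    mul_comm]

lemma integral_sq_gaussMixing (hs : -(1 / 2) ≤ s) (a : Fin k → ℝ≥0) (j : Fin k) :
    ∫ t, (t j : ℝ) ^ 2 ∂gaussMixing s a = 4 * (s + 1) * a j := by
  rw [gaussMixing, integral_sq_rayleighPi hs, coe_sqrt_mul_toNNReal_sq _ (by linarith)]

lemma integrable_coneNormSq_gaussMixing (hs : -(1 / 2) ≤ s) (a : Fin k → ℝ≥0) :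
    Integrable coneNormSq (gaussMixing s a) :=
  integrable_finsetSum _ fun j _ => integrable_sq_rayleighPi hs _ j

/-- The Lévy integrand with the kernel replaced by the Gaussian `gaussFun a`: the average of
`levyIntegrand s t x` over `t` distributed as `gaussMixing s a`. -/
noncomputable def gaussLevyIntegrand (a x : Fin k → ℝ≥0) : ℝ :=
  (1 - gaussFun a x) * ((1 + coneNormSq x) / coneNormSq x)

lemma integral_levyIntegrand_gaussMixing (hs : -(1 / 2) ≤ s) (a x : Fin k → ℝ≥0) :
    ∫ t, levyIntegrand s t x ∂gaussMixing s a = gaussLevyIntegrand a x := by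
  have := isProbabilityMeasure_gaussMixing hs a
  simp only [levyIntegrand, kingmanKernelPi_comm s _ x]
  rw [integral_mul_const, integral_one_sub_kingmanKernelPi hs, probReal_univ,
    radCharFun_gaussMixing hs, gaussLevyIntegrand]

lemma integrable_levyIntegrand_prod_gaussMixing (hs : -(1 / 2) ≤ s) (M : Measure (Fin k → ℝ≥0))
    [IsFiniteMeasure M] (a : Fin k → ℝ≥0) :
    Integrable (fun p : (Fin k → ℝ≥0) × (Fin k → ℝ≥0) => levyIntegrand s p.1 p.2)
      ((gaussMixing s a).prod M) := by
  have := isProbabilityMeasure_gaussMixing hs a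
  have bound : Integrable (fun p : (Fin k → ℝ≥0) × (Fin k → ℝ≥0) => 2 + coneNormSq p.1)
      ((gaussMixing s a).prod M) :=
    (integrable_const _).add ((integrable_coneNormSq_gaussMixing hs a).comp_fst M)
  exact bound.mono' (measurable_levyIntegrand₂ hs).aestronglyMeasurable
    (.of_forall fun p => norm_levyIntegrand_le hs p.1 p.2)

lemma HasLevyRep.integral_neg_log (hs : -(1 / 2) ≤ s) {μ M : Measure (Fin k → ℝ≥0)}
    {l : Fin k → ℝ≥0} (h : HasLevyRep s μ M l) (a : Fin k → ℝ≥0) :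
    ∫ t, -Real.log (radCharFun s μ t) ∂gaussMixing s a =
      4 * (s + 1) * ∑ j, (l j : ℝ) ^ 2 * a j + ∫ x, gaussLevyIntegrand a x ∂M := by
  have := h.isFiniteMeasure hs
  have := isProbabilityMeasure_gaussMixing hs a
  have hprod := integrable_levyIntegrand_prod_gaussMixing hs M a
  have hquad : ∀ j ∈ Finset.univ, Integrable (fun t : Fin k → ℝ≥0 => (l j : ℝ) ^ 2 * (t j : ℝ) ^ 2)
      (gaussMixing s a) := fun j _ => (integrable_sq_rayleighPi hs _ j).const_mul _
  simp only [h.eq]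
  rw [integral_add (integrable_finsetSum _ hquad) hprod.integral_prod_left,
    integral_finsetSum _ hquad, integral_integral_swap hprod, Finset.mul_sum]
  simp only [integral_levyIntegrand_gaussMixing hs, integral_const_mul, integral_sq_gaussMixing hs]
  congr! 2
  ring

lemma gaussLevyIntegrand_nonneg (a x : Fin k → ℝ≥0) : 0 ≤ gaussLevyIntegrand a x :=
  mul_nonneg (sub_nonneg.2 (gaussFun_le_one a x)) (one_add_coneNormSq_div_nonneg x)

lemma gaussLevyIntegrand_le (a x : Fin k → ℝ≥0) :
    gaussLevyIntegrand a x ≤ 2 + ∑ j, (a j : ℝ) := by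
  refine mul_one_add_div_le (coneNormSq_nonneg x) (by positivity)
    (by linarith [gaussFun_pos a x]) ?_
  calc 1 - gaussFun a x ≤ ∑ j, (a j : ℝ) * (x j : ℝ) ^ 2 := by
        rw [gaussFun]
        linarith [Real.add_one_le_exp (-∑ j, (a j : ℝ) * (x j : ℝ) ^ 2)]
    _ ≤ ∑ j, (a j : ℝ) * coneNormSq x := by
        gcongr with j
        exact sq_le_coneNormSq x j
    _ = (∑ j, (a j : ℝ)) * coneNormSq x := (Finset.sum_mul _ _ _).symm

lemma measurable_gaussLevyIntegrand (a : Fin k → ℝ≥0) : Measurable (gaussLevyIntegrand a) := by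
  have := (continuous_gaussFun a).measurable
  have := measurable_coneNormSq (k := k)
  unfold gaussLevyIntegrand
  fun_prop

lemma integrable_gaussLevyIntegrand (M : Measure (Fin k → ℝ≥0)) [IsFiniteMeasure M]
    (a : Fin k → ℝ≥0) : Integrable (gaussLevyIntegrand a) M :=
  .of_bound (measurable_gaussLevyIntegrand a).aestronglyMeasurable (2 + ∑ j, (a j : ℝ))
    (.of_forall fun x => by
      rw [Real.norm_of_nonneg (gaussLevyIntegrand_nonneg a x)]
      exact gaussLevyIntegrand_le a x)

/-- The weight produced by second differences of `gaussLevyIntegrand` in the direction `1`. -/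
noncomputable def gaussWeight (x : Fin k → ℝ≥0) : ℝ := (1 - gaussFun 1 x) * gaussLevyIntegrand 1 x

lemma gaussWeight_mul_gaussFun (a x : Fin k → ℝ≥0) :
    gaussWeight x * gaussFun a x = 2 * gaussLevyIntegrand (a + 1) x - gaussLevyIntegrand a x -
      gaussLevyIntegrand (a + 1 + 1) x := by
  simp only [gaussWeight, gaussLevyIntegrand, gaussFun_add]
  ring

lemma gaussFun_one_lt_one {x : Fin k → ℝ≥0} (hx : x ≠ 0) : gaussFun 1 x < 1 := by
  simpa [gaussFun, coneNormSq] using coneNormSq_pos hx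

lemma gaussWeight_nonneg (x : Fin k → ℝ≥0) : 0 ≤ gaussWeight x :=
  mul_nonneg (sub_nonneg.2 (gaussFun_le_one 1 x)) (gaussLevyIntegrand_nonneg 1 x)

lemma gaussWeight_pos {x : Fin k → ℝ≥0} (hx : x ≠ 0) : 0 < gaussWeight x := by
  have := coneNormSq_pos hx
  have := sub_pos.2 (gaussFun_one_lt_one hx)
  unfold gaussWeight gaussLevyIntegrand
  positivity

lemma measurable_gaussWeight : Measurable (gaussWeight (k := k)) :=
  ((continuous_gaussFun 1).measurable.const_sub 1).mul (measurable_gaussLevyIntegrand 1)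

lemma integrable_gaussWeight (M : Measure (Fin k → ℝ≥0)) [IsFiniteMeasure M] :
    Integrable gaussWeight M := by
  refine (integrable_gaussLevyIntegrand M 1).mono' measurable_gaussWeight.aestronglyMeasurable
    (.of_forall fun x => ?_)
  rw [Real.norm_of_nonneg (gaussWeight_nonneg x)]
  exact mul_le_of_le_one_left (gaussLevyIntegrand_nonneg 1 x) (by linarith [gaussFun_pos 1 x])

lemma integral_gaussWeight_mul_gaussFun (M : Measure (Fin k → ℝ≥0)) [IsFiniteMeasure M]
    (a : Fin k → ℝ≥0) : ∫ x, gaussWeight x * gaussFun a x ∂M =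
      2 * ∫ x, gaussLevyIntegrand (a + 1) x ∂M - ∫ x, gaussLevyIntegrand a x ∂M
        - ∫ x, gaussLevyIntegrand (a + 1 + 1) x ∂M := by
  have hint := integrable_gaussLevyIntegrand M
  have hdiff : Integrable (fun x => 2 * gaussLevyIntegrand (a + 1) x - gaussLevyIntegrand a x) M :=
    ((hint (a + 1)).const_mul 2).sub (hint a)
  simp only [gaussWeight_mul_gaussFun]
  rw [integral_sub hdiff (hint (a + 1 + 1)),
    integral_sub ((hint (a + 1)).const_mul 2) (hint a), integral_const_mul]

/-- The finite measure with density `gaussWeight` with respect to `M`. -/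
noncomputable def gaussWeighted (M : Measure (Fin k → ℝ≥0)) : Measure (Fin k → ℝ≥0) :=
  M.withDensity fun x => ENNReal.ofReal (gaussWeight x)

lemma isFiniteMeasure_gaussWeighted (M : Measure (Fin k → ℝ≥0)) [IsFiniteMeasure M] :
    IsFiniteMeasure (gaussWeighted M) :=
  isFiniteMeasure_withDensity (integrable_gaussWeight M).lintegral_lt_top.ne

lemma integral_gaussWeighted (M : Measure (Fin k → ℝ≥0)) (f : (Fin k → ℝ≥0) → ℝ) :
    ∫ x, f x ∂gaussWeighted M = ∫ x, gaussWeight x * f x ∂M := by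
  rw [gaussWeighted, integral_withDensity_eq_integral_toReal_smul
    measurable_gaussWeight.ennreal_ofReal (by simp)]
  simp only [ENNReal.toReal_ofReal (gaussWeight_nonneg _), smul_eq_mul]

lemma gaussWeighted_injOn : InjOn gaussWeighted {M : Measure (Fin k → ℝ≥0) | M {0} = 0} := by
  have recover (M : Measure (Fin k → ℝ≥0)) (hM : M {0} = 0) : (gaussWeighted M).withDensity
      (fun x => ENNReal.ofReal (gaussWeight x))⁻¹ = M := by
    have hne : ∀ᵐ x ∂M, x ≠ 0 := by
      rw [ae_iff]
      simpa using hM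
    refine withDensity_inv_same measurable_gaussWeight.ennreal_ofReal ?_
      (.of_forall fun x => ENNReal.ofReal_ne_top)
    filter_upwards [hne] with x hx
    simpa using gaussWeight_pos hx
  intro M hM M' hM' h
  rw [← recover M hM, ← recover M' hM', h]

-- The Rayleigh part is linear in `a`, so the second difference of `integral_neg_log` removes it.
lemma HasLevyRep.integral_gaussFun_gaussWeighted (hs : -(1 / 2) ≤ s) {μ M : Measure (Fin k → ℝ≥0)}
    {l : Fin k → ℝ≥0} (h : HasLevyRep s μ M l) (a : Fin k → ℝ≥0) :
    ∫ x, gaussFun a x ∂gaussWeighted M =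
      2 * ∫ t, -Real.log (radCharFun s μ t) ∂gaussMixing s (a + 1) -
        ∫ t, -Real.log (radCharFun s μ t) ∂gaussMixing s a -
        ∫ t, -Real.log (radCharFun s μ t) ∂gaussMixing s (a + 1 + 1) := by
  have := h.isFiniteMeasure hs
  have hlinear (b : Fin k → ℝ≥0) : ∑ j, (l j : ℝ) ^ 2 * ((b + 1) j : ℝ≥0) =
      ∑ j, (l j : ℝ) ^ 2 * b j + ∑ j, (l j : ℝ) ^ 2 := by
    simp only [Pi.add_apply, Pi.one_apply, NNReal.coe_add, NNReal.coe_one, mul_add, mul_one,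
      Finset.sum_add_distrib]
  rw [integral_gaussWeighted, integral_gaussWeight_mul_gaussFun]
  simp only [h.integral_neg_log hs, hlinear]
  ring

theorem HasLevyRep.measure_unique (hs : -(1 / 2) ≤ s) {μ M M' : Measure (Fin k → ℝ≥0)}
    {l l' : Fin k → ℝ≥0} (h : HasLevyRep s μ M l) (h' : HasLevyRep s μ M' l') : M = M' := by
  have := h.isFiniteMeasure hs
  have := h'.isFiniteMeasure hs
  have := isFiniteMeasure_gaussWeighted M
  have := isFiniteMeasure_gaussWeighted M'
  refine gaussWeighted_injOn h.levy.zero h'.levy.zero (ext_of_integral_gaussFun fun a => ?_)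
  rw [h.integral_gaussFun_gaussWeighted hs, h'.integral_gaussFun_gaussWeighted hs]

lemma sum_sq_mul_single_sq (l : Fin k → ℝ≥0) (j : Fin k) :
    ∑ i, (l i : ℝ) ^ 2 * ((Pi.single j 1 : Fin k → ℝ≥0) i : ℝ) ^ 2 = (l j : ℝ) ^ 2 := by
  rw [Finset.sum_eq_single j (fun i _ hi => by simp [hi]) (by simp)]
  simp

theorem HasLevyRep.unique (hs : -(1 / 2) ≤ s) {μ M M' : Measure (Fin k → ℝ≥0)}
    {l l' : Fin k → ℝ≥0} (h : HasLevyRep s μ M l) (h' : HasLevyRep s μ M' l') :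
    M = M' ∧ l = l' := by
  obtain rfl := h.measure_unique hs h'
  refine ⟨rfl, funext fun j => ?_⟩
  have hj := (h.eq (Pi.single j 1)).symm.trans (h'.eq (Pi.single j 1))
  rwa [sum_sq_mul_single_sq, sum_sq_mul_single_sq, add_left_inj,
    sq_eq_sq₀ (NNReal.coe_nonneg _) (NNReal.coe_nonneg _), NNReal.coe_inj] at hj

end Uniqueness

section RayleighianLaws

variable {k : ℕ} {s : ℝ}

lemma pos_and_neg_log_eq_iff {y q : ℝ} : (0 < y ∧ -Real.log y = q) ↔ y = Real.exp (-q) := by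
  constructor
  · rintro ⟨hy, rfl⟩
    rw [neg_neg, Real.exp_log hy]
  · rintro rfl
    exact ⟨Real.exp_pos _, by rw [Real.log_exp, neg_neg]⟩

lemma isRayleighian_iff_radCharFun (hs : -(1 / 2) ≤ s) (μ : Measure (Fin k → ℝ≥0))
    [IsProbabilityMeasure μ] : IsRayleighian s μ ↔ ∃ l : Fin k → ℝ≥0, ∀ t,
      radCharFun s μ t = Real.exp (-∑ j, (l j : ℝ) ^ 2 * (t j : ℝ) ^ 2 / (4 * (s + 1))) := by
  refine exists_congr fun l => ⟨fun h t => h ▸ radCharFun_rayleighPi hs l t, fun h => ?_⟩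
  have := isProbabilityMeasure_rayleighPi hs l
  exact ext_of_radCharFun hs (N' := rayleighPi s l) fun t =>
    (h t).trans (radCharFun_rayleighPi hs l t).symm

lemma exists_sum_sq_div_of_exists {c d : ℝ} (hc : 0 < c) (hd : 0 < d)
    {p : ((Fin k → ℝ≥0) → ℝ) → Prop} :
    (∃ l : Fin k → ℝ≥0, p fun t => ∑ j, (l j : ℝ) ^ 2 * (t j : ℝ) ^ 2 / c) →
      ∃ l : Fin k → ℝ≥0, p fun t => ∑ j, (l j : ℝ) ^ 2 * (t j : ℝ) ^ 2 / d := by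
  rintro ⟨l, hl⟩
  refine ⟨fun j => NNReal.sqrt (d / c).toNNReal * l j, ?_⟩
  convert hl using 1
  refine funext fun t => Finset.sum_congr rfl fun j _ => ?_
  rw [NNReal.coe_mul, mul_pow, Real.coe_sqrt, Real.sq_sqrt (NNReal.coe_nonneg _),
    Real.coe_toNNReal _ (by positivity)]
  field_simp

lemma isRayleighian_iff_exists_exp (hs : -(1 / 2) ≤ s) (μ : Measure (Fin k → ℝ≥0))
    [IsProbabilityMeasure μ] {c : ℝ} (hc : 0 < c) : IsRayleighian s μ ↔ ∃ l : Fin k → ℝ≥0, ∀ t,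
      radCharFun s μ t = Real.exp (-∑ j, (l j : ℝ) ^ 2 * (t j : ℝ) ^ 2 / c) := by
  have ha : 0 < 4 * (s + 1) := by linarith
  rw [isRayleighian_iff_radCharFun hs]
  exact ⟨exists_sum_sq_div_of_exists (p := fun q => ∀ t, radCharFun s μ t = Real.exp (-q t)) ha hc,
    exists_sum_sq_div_of_exists (p := fun q => ∀ t, radCharFun s μ t = Real.exp (-q t)) hc ha⟩

lemma isRayleighian_iff_neg_log (hs : -(1 / 2) ≤ s) (μ : Measure (Fin k → ℝ≥0))
    [IsProbabilityMeasure μ] {c : ℝ} (hc : 0 < c) : IsRayleighian s μ ↔ ∃ l : Fin k → ℝ≥0, ∀ t,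
      0 < radCharFun s μ t ∧
        -Real.log (radCharFun s μ t) = c * ∑ j, (l j : ℝ) ^ 2 * (t j : ℝ) ^ 2 := by
  rw [isRayleighian_iff_exists_exp hs μ (inv_pos.2 hc)]
  simp only [pos_and_neg_log_eq_iff, div_inv_eq_mul, Finset.sum_mul, mul_comm c]

lemma isLevyMeasure_zero : IsLevyMeasure (0 : Measure (Fin k → ℝ≥0)) where
  sigmaFinite := inferInstance
  zero := by simp
  finite_compl := by simp
  lintegral_lt_top := by simp

lemma hasLevyRep_zero_iff (μ : Measure (Fin k → ℝ≥0)) (l : Fin k → ℝ≥0) :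
    HasLevyRep s μ 0 l ↔ ∀ t, 0 < radCharFun s μ t ∧
      -Real.log (radCharFun s μ t) = ∑ j, (l j : ℝ) ^ 2 * (t j : ℝ) ^ 2 := by
  refine ⟨fun h t => ⟨h.pos t, by simpa using h.eq t⟩, fun h => ⟨isLevyMeasure_zero,
    fun t => integrable_zero_measure, fun t => (h t).1, fun t => by simpa using (h t).2⟩⟩

lemma exists_hasLevyRep_zero_iff (hs : -(1 / 2) ≤ s) (μ : Measure (Fin k → ℝ≥0))
    [IsProbabilityMeasure μ] : (∃ l, HasLevyRep s μ 0 l) ↔ IsRayleighian s μ := by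
  simp only [isRayleighian_iff_neg_log hs μ one_pos, hasLevyRep_zero_iff, one_mul]

end RayleighianLaws

section Tightness

variable {k : ℕ} {s : ℝ}

lemma integrable_one_sub_kingmanKernelPi (hs : -(1 / 2) ≤ s) (N : Measure (Fin k → ℝ≥0))
    [IsFiniteMeasure N] (t : Fin k → ℝ≥0) : Integrable (fun x => 1 - kingmanKernelPi s t x) N :=
  (integrable_const _).sub (integrable_kingmanKernelPi hs N t)

/-- The doubling inequality for `1 - Λ_s` carries the bound from `[0, r₀]` to all `r`, at the cost
of a factor `4` for each halving of `r`. -/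
lemma integral_one_sub_kingmanKernelPi_single_le (hs : -(1 / 2) ≤ s) (N : Measure (Fin k → ℝ≥0))
    [IsFiniteMeasure N] {j : Fin k} {r₀ : ℝ≥0} (hr₀ : 0 < r₀) {ε : ℝ}
    (h : ∀ r ≤ r₀, ∫ x, (1 - kingmanKernelPi s (Pi.single j r) x) ∂N ≤ ε) (r : ℝ≥0) :
    ∫ x, (1 - kingmanKernelPi s (Pi.single j r) x) ∂N ≤ ε + 4 * ε / (r₀ : ℝ) ^ 2 * (r : ℝ) ^ 2 := by
  have hε : 0 ≤ ε := (integral_nonneg fun x => one_sub_kingmanKernelPi_nonneg hs _ x).trans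
    (h 0 zero_le)
  have hr₀' : (0 : ℝ) < r₀ := hr₀
  rcases le_total r r₀ with hr | hr
  · exact (h r hr).trans (le_add_of_nonneg_right (by positivity))
  obtain ⟨n, hn, hn'⟩ :=
    exists_nat_pow_near ((one_le_div hr₀').2 (NNReal.coe_le_coe.2 hr)) one_lt_two
  have halved_le : r / 2 ^ (n + 1) ≤ r₀ := by
    rw [div_lt_iff₀ hr₀'] at hn'
    rw [← NNReal.coe_le_coe, NNReal.coe_div, div_le_iff₀ (by positivity)]
    push_cast
    linarith
  have doubling (x : Fin k → ℝ≥0) : 1 - kingmanKernelPi s (Pi.single j r) x ≤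
      4 ^ (n + 1) * (1 - kingmanKernelPi s (Pi.single j (r / 2 ^ (n + 1))) x) := by
    rw [kingmanKernelPi_single hs, kingmanKernelPi_single hs]
    convert one_sub_kingmanKernel_two_pow_mul_le hs (n + 1) _ using 3
    push_cast
    field_simp
  calc ∫ x, (1 - kingmanKernelPi s (Pi.single j r) x) ∂N
      ≤ ∫ x, 4 ^ (n + 1) * (1 - kingmanKernelPi s (Pi.single j (r / 2 ^ (n + 1))) x) ∂N :=
        integral_mono (integrable_one_sub_kingmanKernelPi hs N _)
          ((integrable_one_sub_kingmanKernelPi hs N _).const_mul _) doubling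
    _ ≤ 4 ^ (n + 1) * ε := by
        rw [integral_const_mul]
        gcongr
        exact h _ halved_le
    _ = 4 * ε * (2 ^ n) ^ 2 := by
        rw [← pow_mul, mul_comm n 2, pow_mul, pow_succ]
        norm_num
        ring
    _ ≤ 4 * ε * ((r : ℝ) / r₀) ^ 2 := by gcongr
    _ = 4 * ε / (r₀ : ℝ) ^ 2 * (r : ℝ) ^ 2 := by field_simp
    _ ≤ _ := le_add_of_nonneg_left hε

lemma integral_one_sub_kingmanKernelPi_le (hs : -(1 / 2) ≤ s) (N : Measure (Fin k → ℝ≥0))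
    [IsFiniteMeasure N] {r₀ : ℝ≥0} (hr₀ : 0 < r₀) {ε : ℝ}
    (h : ∀ j, ∀ r ≤ r₀, ∫ x, (1 - kingmanKernelPi s (Pi.single j r) x) ∂N ≤ ε)
    (t : Fin k → ℝ≥0) :
    ∫ x, (1 - kingmanKernelPi s t x) ∂N ≤ k * ε + 4 * ε / (r₀ : ℝ) ^ 2 * coneNormSq t := by
  have hint (j : Fin k) (_ : j ∈ Finset.univ) :=
    integrable_one_sub_kingmanKernelPi hs N (Pi.single j (t j))
  calc ∫ x, (1 - kingmanKernelPi s t x) ∂N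
      ≤ ∫ x, ∑ j, (1 - kingmanKernelPi s (Pi.single j (t j)) x) ∂N := by
        refine integral_mono (integrable_one_sub_kingmanKernelPi hs N t)
          (integrable_finsetSum _ hint) fun x => ?_
        simp only [kingmanKernelPi_single hs]
        exact one_sub_kingmanKernelPi_le_sum hs t x
    _ = ∑ j, ∫ x, (1 - kingmanKernelPi s (Pi.single j (t j)) x) ∂N := integral_finsetSum _ hint
    _ ≤ ∑ j, (ε + 4 * ε / (r₀ : ℝ) ^ 2 * (t j : ℝ) ^ 2) :=
        Finset.sum_le_sum fun j _ => integral_one_sub_kingmanKernelPi_single_le hs N hr₀ (h j) (t j)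
    _ = _ := by
        rw [Finset.sum_add_distrib, ← Finset.mul_sum]
        simp [coneNormSq]

/-- The integrals `∫ (1 - ∏_j Λ_s(t_j x_j)) N_i(dx)` are at most `ε + C ‖t‖²`, uniformly in `i`,
where `ε` can be prescribed. This is a Fourier-side criterion for tightness; see
`HasUniformQuadraticBound.exists_isCompact`. -/
def HasUniformQuadraticBound {ι : Type*} (s : ℝ) (N : ι → Measure (Fin k → ℝ≥0)) : Prop :=
  ∀ ε > 0, ∃ C : ℝ, 0 ≤ C ∧ ∀ i t, ∫ x, (1 - kingmanKernelPi s t x) ∂N i ≤ ε + C * coneNormSq t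

lemma exists_pos_forall_single_of_eventually_nhds_zero {p : (Fin k → ℝ≥0) → Prop}
    (h : ∀ᶠ t in 𝓝 0, p t) : ∃ r₀ : ℝ≥0, 0 < r₀ ∧ ∀ j, ∀ r ≤ r₀, p (Pi.single j r) := by
  have hsingle (j : Fin k) : Tendsto (fun r : ℝ≥0 => (Pi.single j r : Fin k → ℝ≥0)) (𝓝 0) (𝓝 0) :=
    (continuous_single (A := fun _ : Fin k => ℝ≥0) j).tendsto' 0 0 (Pi.single_zero j)
  obtain ⟨r, hr, hr'⟩ := NNReal.nhds_zero_basis.eventually_iff.1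
    (eventually_all.2 fun j => (hsingle j).eventually h)
  exact ⟨r / 2, half_pos hr, fun j r' hr'' => hr' (hr''.trans_lt (NNReal.half_lt_self hr.ne')) j⟩

lemma hasUniformQuadraticBound_of_le {ι : Type*} (hs : -(1 / 2) ≤ s)
    (N : ι → Measure (Fin k → ℝ≥0)) [∀ i, IsFiniteMeasure (N i)] {φ : (Fin k → ℝ≥0) → ℝ}
    (hφ : Tendsto φ (𝓝 0) (𝓝 0))
    (h : ∀ᶠ t in 𝓝 0, ∀ i, ∫ x, (1 - kingmanKernelPi s t x) ∂N i ≤ φ t) :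
    HasUniformQuadraticBound s N := by
  intro ε hε
  have hη : 0 < ε / (k + 1) := by positivity
  have small : ∀ᶠ t in 𝓝 0, ∀ i, ∫ x, (1 - kingmanKernelPi s t x) ∂N i ≤ ε / (k + 1) := by
    filter_upwards [h, hφ.eventually_lt_const hη] with t ht htη i using (ht i).trans htη.le
  obtain ⟨r₀, hr₀, hr⟩ := exists_pos_forall_single_of_eventually_nhds_zero small
  refine ⟨4 * (ε / (k + 1)) / (r₀ : ℝ) ^ 2, by positivity, fun i t => ?_⟩
  refine (integral_one_sub_kingmanKernelPi_le hs (N i) hr₀ (fun j r h => hr j r h i) t).trans ?_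
  gcongr
  rw [mul_div_assoc', div_le_iff₀ (by positivity)]
  nlinarith

lemma abs_radCharFun_le (hs : -(1 / 2) ≤ s) (N : Measure (Fin k → ℝ≥0)) [IsFiniteMeasure N]
    (t : Fin k → ℝ≥0) : |radCharFun s N t| ≤ N.real univ := by
  simpa [radCharFun] using norm_integral_le_of_norm_le_const (μ := N) (C := 1)
    (f := kingmanKernelPi s t) (.of_forall fun x => abs_kingmanKernelPi_le_one hs t x)

lemma integral_coneNormSq_gaussMixing (hs : -(1 / 2) ≤ s) (a : Fin k → ℝ≥0) :
    ∫ t, coneNormSq t ∂gaussMixing s a = 4 * (s + 1) * ∑ j, (a j : ℝ) := by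
  unfold coneNormSq
  rw [gaussMixing, integral_finsetSum _ fun j _ => integrable_sq_rayleighPi hs _ j, Finset.mul_sum]
  exact Finset.sum_congr rfl fun j _ => integral_sq_gaussMixing hs a j

lemma integral_one_sub_gaussFun_le (hs : -(1 / 2) ≤ s) (N : Measure (Fin k → ℝ≥0))
    [IsFiniteMeasure N] {ε C : ℝ}
    (h : ∀ t, ∫ x, (1 - kingmanKernelPi s t x) ∂N ≤ ε + C * coneNormSq t) (a : Fin k → ℝ≥0) :
    ∫ x, (1 - gaussFun a x) ∂N ≤ ε + C * (4 * (s + 1) * ∑ j, (a j : ℝ)) := by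
  have := isProbabilityMeasure_gaussMixing hs a
  have hR : Integrable (radCharFun s N) (gaussMixing s a) :=
    .of_bound (continuous_radCharFun hs N).aestronglyMeasurable _
      (.of_forall (abs_radCharFun_le hs N))
  have hn := (integrable_coneNormSq_gaussMixing hs a).const_mul C
  calc ∫ x, (1 - gaussFun a x) ∂N = ∫ t, (N.real univ - radCharFun s N t) ∂gaussMixing s a := by
        rw [integral_sub (integrable_const _) (integrable_gaussFun N a),
          integral_sub (integrable_const _) hR, integral_radCharFun_gaussMixing hs]
        simp
    _ ≤ ∫ t, (ε + C * coneNormSq t) ∂gaussMixing s a :=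
        integral_mono ((integrable_const _).sub hR) ((integrable_const _).add hn) fun t =>
          (integral_one_sub_kingmanKernelPi hs N t).symm.trans_le (h t)
    _ = _ := by
        rw [integral_add (integrable_const _) hn, integral_const_mul,
          integral_coneNormSq_gaussMixing hs]
        simp

lemma isCompact_coneNormSq_le (R : ℝ) : IsCompact {x : Fin k → ℝ≥0 | coneNormSq x ≤ R} := by
  refine (isCompact_Icc (a := (0 : Fin k → ℝ≥0)) (b := fun _ => R.toNNReal + 1)).of_isClosed_subset
    (isClosed_le continuous_coneNormSq continuous_const) fun x hx => ⟨fun j => zero_le,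
      fun j => ?_⟩
  have hsq : (x j : ℝ) ^ 2 ≤ R := (sq_le_coneNormSq x j).trans hx
  rw [← NNReal.coe_le_coe, NNReal.coe_add, NNReal.coe_one]
  nlinarith [sq_nonneg ((x j : ℝ) - 1), Real.le_coe_toNNReal R]

lemma measureReal_coneNormSq_le_compl_le (N : Measure (Fin k → ℝ≥0)) [IsFiniteMeasure N] {δ : ℝ≥0}
    (hδ : 0 < δ) : N.real {x | coneNormSq x ≤ 1 / δ}ᶜ ≤
      2 * ∫ x, (1 - gaussFun (fun _ => δ) x) ∂N := by
  have half_le : {x : Fin k → ℝ≥0 | coneNormSq x ≤ 1 / δ}ᶜ ⊆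
      {x | 1 / 2 ≤ 1 - gaussFun (fun _ => δ) x} := by
    intro x hx
    have hx' : 1 < δ * coneNormSq x := (div_lt_iff₀' (NNReal.coe_pos.2 hδ)).1 (not_le.1 hx)
    have hexp : gaussFun (fun _ => δ) x = (Real.exp (δ * coneNormSq x))⁻¹ := by
      rw [gaussFun, coneNormSq, Finset.mul_sum, Real.exp_neg]
    have : (Real.exp (δ * coneNormSq x))⁻¹ ≤ 2⁻¹ :=
      inv_anti₀ two_pos (by linarith [Real.add_one_le_exp (δ * coneNormSq x)])
    rw [mem_ofPred_eq, hexp]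
    linarith
  have markov := mul_meas_ge_le_integral_of_nonneg (μ := N)
    (.of_forall fun x => sub_nonneg.2 (gaussFun_le_one (fun _ => δ) x))
    ((integrable_const _).sub (integrable_gaussFun _ _)) (1 / 2)
  linarith [measureReal_mono (μ := N) half_le]

lemma HasUniformQuadraticBound.exists_isCompact {ι : Type*} (hs : -(1 / 2) ≤ s)
    {N : ι → Measure (Fin k → ℝ≥0)} [∀ i, IsFiniteMeasure (N i)]
    (h : HasUniformQuadraticBound s N) {ε : ℝ≥0∞} (hε : 0 < ε) :
    ∃ K : Set (Fin k → ℝ≥0), IsCompact K ∧ ∀ i, N i Kᶜ ≤ ε := by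
  rcases eq_top_or_lt_top ε with rfl | hε'
  · exact ⟨∅, isCompact_empty, fun _ => le_top⟩
  lift ε to ℝ≥0 using hε'.ne
  have hε0 : (0 : ℝ) < ε := by exact_mod_cast hε
  have ha : 0 < s + 1 := by linarith
  obtain ⟨C, hC0, hC⟩ := h (ε / 4) (by positivity)
  set B : ℝ := C * (4 * (s + 1) * k) with hB
  have : 0 ≤ B := by positivity
  set δ : ℝ≥0 := (ε / 4 / (B + 1)).toNNReal
  have hδ : (δ : ℝ) = ε / 4 / (B + 1) := Real.coe_toNNReal _ (by positivity)
  have hδ0 : (0 : ℝ) < δ := by rw [hδ]; positivity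
  have hBδ : B * δ ≤ ε / 4 := by
    rw [hδ, mul_div_assoc', div_le_iff₀ (by positivity)]
    nlinarith
  refine ⟨{x | coneNormSq x ≤ 1 / δ}, isCompact_coneNormSq_le _, fun i => ?_⟩
  have hgauss := integral_one_sub_gaussFun_le hs (N i) (hC i) fun _ => δ
  rw [show C * (4 * (s + 1) * ∑ _j : Fin k, (δ : ℝ)) = B * δ by simp [hB]; ring] at hgauss
  rw [← ENNReal.ofReal_coe_nnreal, ← ofReal_measureReal]
  exact ENNReal.ofReal_le_ofReal (by linarith [measureReal_coneNormSq_le_compl_le (N i) hδ0])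

lemma exists_tendsto_hyperfilter {E : Type*} [MeasurableSpace E] [TopologicalSpace E] [T2Space E]
    [NormalSpace E] [BorelSpace E] (P : ℕ → Measure E) {C : ℝ≥0} (hC : ∀ n, P n univ ≤ C)
    (hP : ∀ ε : ℝ≥0∞, 0 < ε → ∃ K : Set E, IsCompact K ∧ ∀ n, P n Kᶜ ≤ ε) :
    ∃ Q : Measure E, IsFiniteMeasure Q ∧ ∀ f : E → ℝ, Continuous f → (∃ B, ∀ x, |f x| ≤ B) →
      Tendsto (fun n => ∫ x, f x ∂P n) (hyperfilter ℕ : Filter ℕ) (𝓝 (∫ x, f x ∂Q)) := by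
  let P' : ℕ → FiniteMeasure E := fun n => ⟨P n, ⟨(hC n).trans_lt ENNReal.coe_lt_top⟩⟩
  have hu (m : ℕ) : (0 : ℝ≥0∞) < (1 / ((m : ℝ≥0) + 1) : ℝ≥0) := by
    rw [ENNReal.coe_pos]
    positivity
  choose K hK hPK using fun m => hP _ (hu m)
  have prokhorov := isCompact_setOfPred_finiteMeasure_mass_le_compl_isCompact_le C
    (tendsto_one_div_add_atTop_nhds_zero_nat (𝕜 := ℝ≥0)) hK (.inl inferInstance)
  obtain ⟨Q, -, hQ⟩ := prokhorov.ultrafilter_le_nhds ((hyperfilter ℕ).map P')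
    (le_principal_iff.2 (Ultrafilter.mem_map.2 (univ_mem' fun n =>
      ⟨ENNReal.toNNReal_mono ENNReal.coe_ne_top (hC n),
        fun m => ENNReal.toNNReal_mono ENNReal.coe_ne_top (hPK m n)⟩)))
  have hQ' : Tendsto P' (hyperfilter ℕ : Filter ℕ) (𝓝 Q) := hQ
  exact ⟨Q, inferInstance, fun f hf ⟨B, hB⟩ =>
    FiniteMeasure.tendsto_iff_forall_integral_tendsto.1 hQ'
      (BoundedContinuousFunction.ofNormedAddCommGroup f hf B hB)⟩

end Tightness

section Roots

variable {k : ℕ} {s : ℝ}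

lemma IsKingmanID.exists_nonneg_roots (hs : -(1 / 2) ≤ s) {μ : Measure (Fin k → ℝ≥0)}
    (h : IsKingmanID s μ) : ∃ ν : ℕ → Measure (Fin k → ℝ≥0),
      (∀ n, IsProbabilityMeasure (ν n)) ∧ (∀ n t, 0 ≤ radCharFun s (ν n) t) ∧
        ∀ n t, radCharFun s (ν n) t ^ (n + 1) = radCharFun s μ t := by
  -- The square of a root of order `2 (n + 1)` has a nonnegative transform.
  have squared_root (n : ℕ) : ∃ ν : Measure (Fin k → ℝ≥0), IsProbabilityMeasure ν ∧
      (∀ t, 0 ≤ radCharFun s ν t) ∧ ∀ t, radCharFun s ν t ^ (n + 1) = radCharFun s μ t := by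
    obtain ⟨ρ, hρ, hμ⟩ := h (2 * (n + 1)) (by omega)
    refine ⟨kingmanConv s ρ ρ, isProbabilityMeasure_kingmanConv hs ρ ρ, fun t => ?_, fun t => ?_⟩
    · rw [radCharFun_kingmanConv hs]
      exact mul_self_nonneg _
    · rw [radCharFun_kingmanConv hs, hμ, radCharFun_kingmanPow hs, ← sq, ← pow_mul]
  choose ν hprob hnonneg hpow using squared_root
  exact ⟨ν, hprob, hnonneg, hpow⟩

lemma natCast_mul_one_sub_le_neg_log {n : ℕ} {y a : ℝ} (ha : 0 < a) (hy : 0 ≤ y)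
    (h : y ^ n = a) : n * (1 - y) ≤ -Real.log a := by
  rcases hy.eq_or_lt with rfl | hy
  · obtain rfl : n = 0 := by
      by_contra hn
      exact ha.ne ((zero_pow hn).symm.trans h)
    rw [pow_zero] at h
    simp [← h]
  · rw [← h, Real.log_pow, ← mul_neg]
    gcongr
    linarith [Real.log_le_sub_one_of_pos hy]

lemma tendsto_natCast_mul_one_sub {y : ℕ → ℝ} {a : ℝ} (ha : 0 < a) (hy : ∀ n, 0 ≤ y n)
    (h : ∀ n, y n ^ (n + 1) = a) :
    Tendsto (fun n : ℕ => ((n + 1 : ℕ) : ℝ) * (1 - y n)) atTop (𝓝 (-Real.log a)) := by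
  have root_eq (n : ℕ) : y n = Real.exp (Real.log a * (1 / ((n : ℝ) + 1))) := by
    refine (pow_left_inj₀ (hy n) (Real.exp_pos _).le n.succ_ne_zero).1 ((h n).trans ?_)
    rw [← Real.exp_nat_mul, ← mul_assoc, mul_right_comm]
    push_cast
    rw [mul_one_div_cancel (by positivity), one_mul, Real.exp_log ha]
  have hderiv : HasDerivAt (fun r : ℝ => Real.exp (Real.log a * r)) (Real.log a) 0 := by
    simpa using ((hasDerivAt_id (0 : ℝ)).const_mul (Real.log a)).exp
  have slope := hderiv.tendsto_slope_zero_right.comp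
    (tendsto_nhdsWithin_iff.2 ⟨tendsto_one_div_add_atTop_nhds_zero_nat (𝕜 := ℝ),
      .of_forall fun n => mem_Ioi.2 (by positivity)⟩)
  refine slope.neg.congr fun n => ?_
  simp only [Function.comp_apply, zero_add, mul_zero, Real.exp_zero, smul_eq_mul]
  rw [← root_eq]
  push_cast
  field_simp
  ring

lemma tendsto_radCharFun_nhds_zero (hs : -(1 / 2) ≤ s) (μ : Measure (Fin k → ℝ≥0))
    [IsProbabilityMeasure μ] : Tendsto (radCharFun s μ) (𝓝 0) (𝓝 1) :=
  (continuous_radCharFun hs μ).tendsto' 0 1 (by simp [radCharFun_zero hs])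

lemma tendsto_neg_log_radCharFun_nhds_zero (hs : -(1 / 2) ≤ s) (μ : Measure (Fin k → ℝ≥0))
    [IsProbabilityMeasure μ] : Tendsto (fun t => -Real.log (radCharFun s μ t)) (𝓝 0) (𝓝 0) := by
  simpa using ((tendsto_radCharFun_nhds_zero hs μ).log one_ne_zero).neg

lemma integral_one_sub_natCast_smul (hs : -(1 / 2) ≤ s) (ν : Measure (Fin k → ℝ≥0))
    [IsProbabilityMeasure ν] (n : ℕ) (t : Fin k → ℝ≥0) :
    ∫ x, (1 - kingmanKernelPi s t x) ∂((n : ℝ≥0) • ν) = n * (1 - radCharFun s ν t) := by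
  rw [integral_smul_nnreal_measure, integral_one_sub_kingmanKernelPi hs]
  simp [NNReal.smul_def]

lemma hasUniformQuadraticBound_roots (hs : -(1 / 2) ≤ s) {μ : Measure (Fin k → ℝ≥0)}
    [IsProbabilityMeasure μ] {ν : ℕ → Measure (Fin k → ℝ≥0)} [∀ n, IsProbabilityMeasure (ν n)]
    (hnonneg : ∀ n t, 0 ≤ radCharFun s (ν n) t)
    (hpow : ∀ n t, radCharFun s (ν n) t ^ (n + 1) = radCharFun s μ t) :
    HasUniformQuadraticBound s fun n => ((n + 1 : ℕ) : ℝ≥0) • ν n := by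
  refine hasUniformQuadraticBound_of_le hs _ (tendsto_neg_log_radCharFun_nhds_zero hs μ) ?_
  filter_upwards [(tendsto_radCharFun_nhds_zero hs μ).eventually_const_lt one_pos] with t ht n
  rw [integral_one_sub_natCast_smul hs]
  exact natCast_mul_one_sub_le_neg_log ht (hnonneg n t) (hpow n t)

lemma radCharFun_pos_of_roots (hs : -(1 / 2) ≤ s) {μ : Measure (Fin k → ℝ≥0)}
    [IsProbabilityMeasure μ] {ν : ℕ → Measure (Fin k → ℝ≥0)} [∀ n, IsProbabilityMeasure (ν n)]
    (hnonneg : ∀ n t, 0 ≤ radCharFun s (ν n) t)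
    (hpow : ∀ n t, radCharFun s (ν n) t ^ (n + 1) = radCharFun s μ t) (t : Fin k → ℝ≥0) :
    0 < radCharFun s μ t := by
  obtain ⟨C, -, hC⟩ := hasUniformQuadraticBound_roots hs hnonneg hpow 1 one_pos
  obtain ⟨n, hn⟩ := exists_nat_gt (1 + C * coneNormSq t)
  have defect_le := hC n t
  rw [integral_one_sub_natCast_smul hs] at defect_le
  rw [← hpow n t]
  refine pow_pos ((hnonneg n t).lt_of_ne fun hzero => ?_) _
  rw [← hzero] at defect_le
  push_cast at defect_le
  linarith

end Roots

section BlowUp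

variable {k : ℕ} {s : ℝ}

/-- The squared direction cosines `x_j² / ‖x‖²`, with the junk value `0` at the origin. The
closure of the set of pairs `(x, coneDirection x)` with `x ≠ 0` is the blow-up of the cone at the
origin, to which the Lévy integrand extends continuously. -/
noncomputable def coneDirection (x : Fin k → ℝ≥0) (j : Fin k) : unitInterval :=
  ⟨(x j : ℝ) ^ 2 / coneNormSq x, div_nonneg (sq_nonneg _) (coneNormSq_nonneg x),
    div_le_one_of_le₀ (sq_le_coneNormSq x j) (coneNormSq_nonneg x)⟩

lemma measurable_coneDirection : Measurable (coneDirection (k := k)) := by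
  have := measurable_coneNormSq (k := k)
  refine measurable_pi_lambda _ fun j => Measurable.subtype_mk ?_
  fun_prop

/-- The limit of `levyIntegrand s t x` as `x` tends to the origin with squared direction cosines
tending to `d`. -/
noncomputable def directionalLimit (s : ℝ) (t : Fin k → ℝ≥0) (d : Fin k → unitInterval) : ℝ :=
  ∑ j, (t j : ℝ) ^ 2 / (4 * (s + 1)) * (d j : ℝ)

lemma continuous_directionalLimit (s : ℝ) (t : Fin k → ℝ≥0) :
    Continuous (directionalLimit s t) := by
  unfold directionalLimit
  fun_prop

lemma directionalLimit_coneDirection (s : ℝ) (t x : Fin k → ℝ≥0) :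
    directionalLimit s t (coneDirection x) =
      (∑ j, (t j : ℝ) ^ 2 * (x j : ℝ) ^ 2 / (4 * (s + 1))) / coneNormSq x := by
  rw [directionalLimit, Finset.sum_div]
  refine Finset.sum_congr rfl fun j _ => ?_
  rw [coneDirection]
  ring

lemma directionalLimit_nonneg (hs : -(1 / 2) ≤ s) (t : Fin k → ℝ≥0) (d : Fin k → unitInterval) :
    0 ≤ directionalLimit s t d := by
  have : 0 < s + 1 := by linarith
  exact Finset.sum_nonneg fun j _ => mul_nonneg (by positivity) (d j).2.1

lemma directionalLimit_le (hs : -(1 / 2) ≤ s) (t : Fin k → ℝ≥0) (d : Fin k → unitInterval) :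
    directionalLimit s t d ≤ coneNormSq t := by
  refine Finset.sum_le_sum fun j _ => ?_
  have : 0 < s + 1 := by linarith
  calc (t j : ℝ) ^ 2 / (4 * (s + 1)) * (d j : ℝ) ≤ (t j : ℝ) ^ 2 / (4 * (s + 1)) :=
        mul_le_of_le_one_right (by positivity) (d j).2.2
    _ ≤ (t j : ℝ) ^ 2 := div_le_self (sq_nonneg _) (by linarith)

/-- The part of the Lévy integrand which extends continuously by `0` to the origin. -/
noncomputable def levyRemainder (s : ℝ) (t x : Fin k → ℝ≥0) : ℝ :=
  levyIntegrand s t x - directionalLimit s t (coneDirection x)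

/-- At the origin both sides vanish, by the conventions `0 / 0 = 0`. -/
lemma levyRemainder_eq (hs : -(1 / 2) ≤ s) (t x : Fin k → ℝ≥0) :
    levyRemainder s t x = 1 - kingmanKernelPi s t x - (kingmanKernelPi s t x -
      (1 - ∑ j, (t j : ℝ) ^ 2 * (x j : ℝ) ^ 2 / (4 * (s + 1)))) / coneNormSq x := by
  rw [levyRemainder, directionalLimit_coneDirection, levyIntegrand]
  rcases eq_or_ne x 0 with rfl | hx
  · simp [kingmanKernelPi_zero_right hs, coneNormSq_zero]
  · have := (coneNormSq_pos hx).ne'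
    field_simp
    ring

lemma levyRemainder_zero (hs : -(1 / 2) ≤ s) (t : Fin k → ℝ≥0) : levyRemainder s t 0 = 0 := by
  simp [levyRemainder_eq hs, kingmanKernelPi_zero_right hs]

lemma continuous_levyRemainder (hs : -(1 / 2) ≤ s) (t : Fin k → ℝ≥0) :
    Continuous (levyRemainder s t) := by
  have hK := continuous_kingmanKernelPi hs t
  have hn := continuous_coneNormSq (k := k)
  simp only [funext (levyRemainder_eq hs t)]
  refine (continuous_const.sub hK).sub (continuous_iff_continuousAt.2 fun x => ?_)
  rcases eq_or_ne x 0 with rfl | hx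
  · rw [ContinuousAt, coneNormSq_zero, div_zero]
    exact (kingmanKernelPi_sub_isLittleO hs t).tendsto_div_nhds_zero
  · exact (Continuous.continuousAt (by fun_prop)).div hn.continuousAt (coneNormSq_pos hx).ne'

/-- The continuous extension of `levyIntegrand s t` to the blow-up of the cone at the origin. -/
noncomputable def levyBlowup (s : ℝ) (t : Fin k → ℝ≥0)
    (p : (Fin k → ℝ≥0) × (Fin k → unitInterval)) : ℝ :=
  levyRemainder s t p.1 + directionalLimit s t p.2

lemma continuous_levyBlowup (hs : -(1 / 2) ≤ s) (t : Fin k → ℝ≥0) :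
    Continuous (levyBlowup s t) :=
  ((continuous_levyRemainder hs t).comp continuous_fst).add
    ((continuous_directionalLimit s t).comp continuous_snd)

lemma levyBlowup_coneDirection (s : ℝ) (t x : Fin k → ℝ≥0) :
    levyBlowup s t (x, coneDirection x) = levyIntegrand s t x :=
  sub_add_cancel _ _

lemma levyBlowup_zero_left (hs : -(1 / 2) ≤ s) (t : Fin k → ℝ≥0) (d : Fin k → unitInterval) :
    levyBlowup s t (0, d) = directionalLimit s t d := by
  rw [levyBlowup, levyRemainder_zero hs, zero_add]

lemma abs_levyBlowup_le (hs : -(1 / 2) ≤ s) (t : Fin k → ℝ≥0)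
    (p : (Fin k → ℝ≥0) × (Fin k → unitInterval)) :
    |levyBlowup s t p| ≤ 2 + 2 * coneNormSq t := by
  have := directionalLimit_nonneg hs t p.2
  have := directionalLimit_le hs t p.2
  have := directionalLimit_nonneg hs t (coneDirection p.1)
  have := directionalLimit_le hs t (coneDirection p.1)
  have := levyIntegrand_nonneg hs t p.1
  have := levyIntegrand_le hs t p.1
  rw [levyBlowup, levyRemainder, abs_le]
  constructor <;> linarith

lemma integrable_levyBlowup (hs : -(1 / 2) ≤ s)
    (Q : Measure ((Fin k → ℝ≥0) × (Fin k → unitInterval))) [IsFiniteMeasure Q] (t : Fin k → ℝ≥0) :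
    Integrable (levyBlowup s t) Q :=
  .of_bound (continuous_levyBlowup hs t).aestronglyMeasurable _
    (.of_forall (abs_levyBlowup_le hs t))

/-- The defect in the relations `d_j ‖x‖² = x_j²`, truncated at `1` to be bounded. It vanishes on
the blow-up of the cone, and off the origin it vanishes nowhere else. -/
noncomputable def blowupDefect (p : (Fin k → ℝ≥0) × (Fin k → unitInterval)) : ℝ :=
  min 1 (∑ j, |(p.2 j : ℝ) * coneNormSq p.1 - (p.1 j : ℝ) ^ 2|)

lemma continuous_blowupDefect : Continuous (blowupDefect (k := k)) := by
  have := continuous_coneNormSq (k := k)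
  unfold blowupDefect
  fun_prop

lemma blowupDefect_nonneg (p : (Fin k → ℝ≥0) × (Fin k → unitInterval)) : 0 ≤ blowupDefect p :=
  le_min zero_le_one (Finset.sum_nonneg fun _ _ => abs_nonneg _)

lemma abs_blowupDefect_le_one (p : (Fin k → ℝ≥0) × (Fin k → unitInterval)) :
    |blowupDefect p| ≤ 1 := by
  rw [abs_of_nonneg (blowupDefect_nonneg p)]
  exact min_le_left _ _

lemma blowupDefect_coneDirection (x : Fin k → ℝ≥0) : blowupDefect (x, coneDirection x) = 0 := by
  rcases eq_or_ne x 0 with rfl | hx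
  · simp [blowupDefect, coneNormSq_zero]
  · simp [blowupDefect, coneDirection, div_mul_cancel₀ _ (coneNormSq_pos hx).ne']

lemma eq_coneDirection_of_blowupDefect_eq_zero {x : Fin k → ℝ≥0} (hx : x ≠ 0)
    {d : Fin k → unitInterval} (h : blowupDefect (x, d) = 0) : d = coneDirection x := by
  have sum_eq : ∑ j, |(d j : ℝ) * coneNormSq x - (x j : ℝ) ^ 2| = 0 := by
    by_contra hne
    have := (Finset.sum_nonneg fun j _ => abs_nonneg _).lt_of_ne' hne
    exact (lt_min one_pos this).ne' h
  ext j
  have term_eq := (Finset.sum_eq_zero_iff_of_nonneg fun _ _ => abs_nonneg _).1 sum_eq j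
    (Finset.mem_univ j)
  rw [abs_eq_zero, sub_eq_zero] at term_eq
  exact (eq_div_iff (coneNormSq_pos hx).ne').2 term_eq

lemma ae_blowupDefect_eq_zero {Q : Measure ((Fin k → ℝ≥0) × (Fin k → unitInterval))}
    [IsFiniteMeasure Q] (hQ : ∫ p, blowupDefect p ∂Q = 0) : ∀ᵐ p ∂Q, blowupDefect p = 0 :=
  (integral_eq_zero_iff_of_nonneg blowupDefect_nonneg
    (.of_bound continuous_blowupDefect.aestronglyMeasurable 1
      (.of_forall abs_blowupDefect_le_one))).1 hQ

lemma measurableSet_fst_eq_zero :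
    MeasurableSet {p : (Fin k → ℝ≥0) × (Fin k → unitInterval) | p.1 = 0} :=
  measurable_fst (measurableSet_singleton 0)

lemma setIntegral_levyBlowup_fst_eq_zero (hs : -(1 / 2) ≤ s)
    (Q : Measure ((Fin k → ℝ≥0) × (Fin k → unitInterval))) [IsFiniteMeasure Q]
    (t : Fin k → ℝ≥0) : ∫ p in {p | p.1 = 0}, levyBlowup s t p ∂Q =
      ∑ j, (∫ p in {p | p.1 = 0}, (p.2 j : ℝ) ∂Q) / (4 * (s + 1)) * (t j : ℝ) ^ 2 := by
  have hcoord (j : Fin k) : Integrable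
      (fun p : (Fin k → ℝ≥0) × (Fin k → unitInterval) => (p.2 j : ℝ))
      (Q.restrict {p | p.1 = 0}) :=
    .of_bound (Continuous.aestronglyMeasurable (by fun_prop)) 1 (.of_forall fun p =>
      (Real.norm_of_nonneg (p.2 j).2.1).trans_le (p.2 j).2.2)
  have eq_limit : EqOn (levyBlowup s t) (fun p => directionalLimit s t p.2)
      {p : (Fin k → ℝ≥0) × (Fin k → unitInterval) | p.1 = 0} := by
    rintro ⟨_, d⟩ rfl
    exact levyBlowup_zero_left hs t d
  rw [setIntegral_congr_fun measurableSet_fst_eq_zero eq_limit]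
  simp only [directionalLimit]
  rw [integral_finsetSum _ fun j _ => (hcoord j).const_mul _]
  simp only [integral_const_mul]
  exact Finset.sum_congr rfl fun j _ => by ring

lemma setIntegral_levyBlowup_fst_ne_zero (hs : -(1 / 2) ≤ s)
    {Q : Measure ((Fin k → ℝ≥0) × (Fin k → unitInterval))} [IsFiniteMeasure Q]
    (hQ : ∫ p, blowupDefect p ∂Q = 0) (t : Fin k → ℝ≥0) :
    ∫ p in {p | p.1 = 0}ᶜ, levyBlowup s t p ∂Q =
      ∫ x, levyIntegrand s t x ∂(Q.restrict {p | p.1 = 0}ᶜ).map Prod.fst := by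
  rw [integral_map measurable_fst.aemeasurable (measurable_levyIntegrand hs t).aestronglyMeasurable]
  refine setIntegral_congr_ae measurableSet_fst_eq_zero.compl ?_
  filter_upwards [ae_blowupDefect_eq_zero hQ] with ⟨x, d⟩ hdefect hx
  rw [eq_coneDirection_of_blowupDefect_eq_zero hx hdefect, levyBlowup_coneDirection]

/-- The part of `Q` over the origin gives the quadratic term, the rest gives `M`. -/
lemma exists_integral_levyBlowup_eq (hs : -(1 / 2) ≤ s)
    (Q : Measure ((Fin k → ℝ≥0) × (Fin k → unitInterval))) [IsFiniteMeasure Q]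
    (hQ : ∫ p, blowupDefect p ∂Q = 0) :
    ∃ (M : Measure (Fin k → ℝ≥0)) (l : Fin k → ℝ≥0), IsFiniteMeasure M ∧ M {0} = 0 ∧
      ∀ t, ∫ p, levyBlowup s t p ∂Q =
        ∑ j, (l j : ℝ) ^ 2 * (t j : ℝ) ^ 2 + ∫ x, levyIntegrand s t x ∂M := by
  have ha : 0 < s + 1 := by linarith
  refine ⟨(Q.restrict {p | p.1 = 0}ᶜ).map Prod.fst,
    fun j => NNReal.sqrt ((∫ p in {p | p.1 = 0}, (p.2 j : ℝ) ∂Q) / (4 * (s + 1))).toNNReal,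
    inferInstance, ?_, fun t => ?_⟩
  · rw [Measure.map_apply measurable_fst (measurableSet_singleton 0),
      Measure.restrict_apply (measurable_fst (measurableSet_singleton 0))]
    exact (congrArg Q (inter_compl_self _)).trans measure_empty
  · rw [← integral_add_compl measurableSet_fst_eq_zero (integrable_levyBlowup hs Q t),
      setIntegral_levyBlowup_fst_eq_zero hs, setIntegral_levyBlowup_fst_ne_zero hs hQ]
    congr! 3 with j
    have : 0 ≤ ∫ p in {p | p.1 = 0}, (p.2 j : ℝ) ∂Q := integral_nonneg fun p => (p.2 j).2.1
    rw [Real.coe_sqrt, Real.sq_sqrt (NNReal.coe_nonneg _), Real.coe_toNNReal _ (by positivity)]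

end BlowUp

section Existence

variable {k : ℕ} {s : ℝ}

/-- The weight `‖x‖² / (1 + ‖x‖²)`, which turns `1 - ∏_j Λ_s(t_j x_j)` into the Lévy integrand. -/
noncomputable def coneWeight (x : Fin k → ℝ≥0) : ℝ := coneNormSq x / (1 + coneNormSq x)

lemma continuous_coneWeight : Continuous (coneWeight (k := k)) :=
  continuous_coneNormSq.div (continuous_const.add continuous_coneNormSq) fun x =>
    (add_pos_of_pos_of_nonneg one_pos (coneNormSq_nonneg x)).ne'

lemma coneWeight_nonneg (x : Fin k → ℝ≥0) : 0 ≤ coneWeight x :=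
  div_nonneg (coneNormSq_nonneg x) (by linarith [coneNormSq_nonneg x])

lemma coneWeight_le_one (x : Fin k → ℝ≥0) : coneWeight x ≤ 1 :=
  div_le_one_of_le₀ (by linarith) (by linarith [coneNormSq_nonneg x])

lemma integrable_coneWeight (N : Measure (Fin k → ℝ≥0)) [IsFiniteMeasure N] :
    Integrable coneWeight N :=
  .of_bound continuous_coneWeight.aestronglyMeasurable 1 (.of_forall fun x =>
    (Real.norm_of_nonneg (coneWeight_nonneg x)).trans_le (coneWeight_le_one x))

lemma coneWeight_le_one_sub_gaussFun (x : Fin k → ℝ≥0) : coneWeight x ≤ 1 - gaussFun 1 x := by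
  have hn := coneNormSq_nonneg x
  have gauss_eq : gaussFun 1 x = (Real.exp (coneNormSq x))⁻¹ := by
    simp [gaussFun, coneNormSq, Real.exp_neg]
  have weight_eq : coneWeight x = 1 - (1 + coneNormSq x)⁻¹ := by
    unfold coneWeight
    field_simp
    ring
  rw [gauss_eq, weight_eq]
  gcongr
  linarith [Real.add_one_le_exp (coneNormSq x)]

lemma coneWeight_mul_levyIntegrand (hs : -(1 / 2) ≤ s) (t x : Fin k → ℝ≥0) :
    coneWeight x * levyIntegrand s t x = 1 - kingmanKernelPi s t x := by
  rcases eq_or_ne x 0 with rfl | hx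
  · simp [levyIntegrand, kingmanKernelPi_zero_right hs]
  · have := coneNormSq_pos hx
    unfold coneWeight levyIntegrand
    field_simp

lemma isLevyMeasure_of_isFiniteMeasure (M : Measure (Fin k → ℝ≥0)) [IsFiniteMeasure M]
    (h : M {0} = 0) : IsLevyMeasure M where
  sigmaFinite := inferInstance
  zero := h
  finite_compl := fun _ _ => measure_lt_top _ _
  lintegral_lt_top := (integrable_coneWeight M).lintegral_lt_top

lemma withDensity_coneWeight_le (N : Measure (Fin k → ℝ≥0)) :
    (N.withDensity fun x => ENNReal.ofReal (coneWeight x)) ≤ N :=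
  (withDensity_mono (.of_forall fun x => ENNReal.ofReal_le_one.2 (coneWeight_le_one x))).trans_eq
    withDensity_one

lemma withDensity_coneWeight_univ (N : Measure (Fin k → ℝ≥0)) [IsFiniteMeasure N] :
    (N.withDensity fun x => ENNReal.ofReal (coneWeight x)) univ =
      ENNReal.ofReal (∫ x, coneWeight x ∂N) := by
  rw [withDensity_apply _ MeasurableSet.univ, Measure.restrict_univ,
    ofReal_integral_eq_lintegral_ofReal (integrable_coneWeight N) (.of_forall coneWeight_nonneg)]

/-- The image of the weighted measure `‖x‖² / (1 + ‖x‖²) N(dx)` in the blow-up of the cone at the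
origin. -/
noncomputable def blowupMeasure (N : Measure (Fin k → ℝ≥0)) :
    Measure ((Fin k → ℝ≥0) × (Fin k → unitInterval)) :=
  (N.withDensity fun x => ENNReal.ofReal (coneWeight x)).map fun x => (x, coneDirection x)

lemma measurable_prodMk_coneDirection :
    Measurable fun x : Fin k → ℝ≥0 => (x, coneDirection x) :=
  measurable_id.prodMk measurable_coneDirection

lemma integral_blowupMeasure (N : Measure (Fin k → ℝ≥0))
    {f : (Fin k → ℝ≥0) × (Fin k → unitInterval) → ℝ} (hf : Continuous f) :
    ∫ p, f p ∂blowupMeasure N = ∫ x, coneWeight x * f (x, coneDirection x) ∂N := by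
  rw [blowupMeasure, integral_map measurable_prodMk_coneDirection.aemeasurable
      hf.aestronglyMeasurable,
    integral_withDensity_eq_integral_toReal_smul continuous_coneWeight.measurable.ennreal_ofReal
      (by simp)]
  simp only [ENNReal.toReal_ofReal (coneWeight_nonneg _), smul_eq_mul]

lemma integral_blowupDefect_blowupMeasure (N : Measure (Fin k → ℝ≥0)) :
    ∫ p, blowupDefect p ∂blowupMeasure N = 0 := by
  simp [integral_blowupMeasure N continuous_blowupDefect, blowupDefect_coneDirection]

lemma integral_levyBlowup_blowupMeasure (hs : -(1 / 2) ≤ s) (N : Measure (Fin k → ℝ≥0))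
    (t : Fin k → ℝ≥0) :
    ∫ p, levyBlowup s t p ∂blowupMeasure N = ∫ x, (1 - kingmanKernelPi s t x) ∂N := by
  simp only [integral_blowupMeasure N (continuous_levyBlowup hs t), levyBlowup_coneDirection,
    coneWeight_mul_levyIntegrand hs]

lemma HasUniformQuadraticBound.exists_blowupMeasure_univ_le {ι : Type*} (hs : -(1 / 2) ≤ s)
    {N : ι → Measure (Fin k → ℝ≥0)} [∀ i, IsFiniteMeasure (N i)]
    (h : HasUniformQuadraticBound s N) : ∃ C : ℝ≥0, ∀ i, blowupMeasure (N i) univ ≤ C := by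
  obtain ⟨C, -, hC⟩ := h 1 one_pos
  refine ⟨(1 + C * (4 * (s + 1) * ∑ j : Fin k, ((1 : Fin k → ℝ≥0) j : ℝ))).toNNReal, fun i => ?_⟩
  rw [blowupMeasure, Measure.map_apply measurable_prodMk_coneDirection MeasurableSet.univ,
    preimage_univ, withDensity_coneWeight_univ]
  refine ENNReal.ofReal_le_ofReal (le_trans ?_ (integral_one_sub_gaussFun_le hs (N i) (hC i) 1))
  exact integral_mono (integrable_coneWeight _)
    ((integrable_const _).sub (integrable_gaussFun _ _)) coneWeight_le_one_sub_gaussFun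

lemma HasUniformQuadraticBound.exists_isCompact_blowupMeasure {ι : Type*} (hs : -(1 / 2) ≤ s)
    {N : ι → Measure (Fin k → ℝ≥0)} [∀ i, IsFiniteMeasure (N i)]
    (h : HasUniformQuadraticBound s N) {ε : ℝ≥0∞} (hε : 0 < ε) :
    ∃ K : Set ((Fin k → ℝ≥0) × (Fin k → unitInterval)), IsCompact K ∧
      ∀ i, blowupMeasure (N i) Kᶜ ≤ ε := by
  obtain ⟨K, hK, hNK⟩ := h.exists_isCompact hs hε
  refine ⟨K ×ˢ univ, hK.prod isCompact_univ, fun i => ?_⟩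
  rw [blowupMeasure, Measure.map_apply measurable_prodMk_coneDirection
    (hK.measurableSet.prod MeasurableSet.univ).compl, preimage_compl, mk_preimage_prod,
    preimage_univ, inter_univ]
  exact (withDensity_coneWeight_le (N i) _).trans (hNK i)

theorem IsKingmanID.exists_hasLevyRep (hs : -(1 / 2) ≤ s) {μ : Measure (Fin k → ℝ≥0)}
    [IsProbabilityMeasure μ] (h : IsKingmanID s μ) : ∃ M l, HasLevyRep s μ M l := by
  obtain ⟨ν, hν, hnonneg, hpow⟩ := h.exists_nonneg_roots hs
  have hpos := radCharFun_pos_of_roots hs hnonneg hpow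
  have hbound := hasUniformQuadraticBound_roots hs hnonneg hpow
  obtain ⟨C, hC⟩ := hbound.exists_blowupMeasure_univ_le hs
  obtain ⟨Q, hQ, hlim⟩ := exists_tendsto_hyperfilter
    (fun n => blowupMeasure (((n + 1 : ℕ) : ℝ≥0) • ν n)) hC
    fun ε hε => hbound.exists_isCompact_blowupMeasure hs hε
  have hdefect : ∫ p, blowupDefect p ∂Q = 0 := by
    have := hlim blowupDefect continuous_blowupDefect ⟨1, abs_blowupDefect_le_one⟩
    simp only [integral_blowupDefect_blowupMeasure] at this
    exact tendsto_nhds_unique this tendsto_const_nhds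
  have hexponent (t : Fin k → ℝ≥0) :
      -Real.log (radCharFun s μ t) = ∫ p, levyBlowup s t p ∂Q := by
    have := hlim (levyBlowup s t) (continuous_levyBlowup hs t) ⟨_, abs_levyBlowup_le hs t⟩
    simp only [integral_levyBlowup_blowupMeasure hs, integral_one_sub_natCast_smul hs] at this
    exact tendsto_nhds_unique ((tendsto_natCast_mul_one_sub (hpos t) (fun n => hnonneg n t)
      fun n => hpow n t).mono_left Nat.hyperfilter_le_atTop) this
  obtain ⟨M, l, hM, hM0, hrep⟩ := exists_integral_levyBlowup_eq hs Q hdefect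
  exact ⟨M, l, isLevyMeasure_of_isFiniteMeasure M hM0, integrable_levyIntegrand hs M, hpos,
    fun t => (hexponent t).trans (hrep t)⟩

end Existence

section Attained

variable {k : ℕ} {s : ℝ}

/-- The compound Poisson law of intensity `N`, that is `exp (-N(univ)) ∑ n, N^n / n!` with powers
taken for the Kingman convolution. It is the law with exponent `∫ x, (1 - ∏_j Λ_s(t_j x_j)) ∂N`. -/
noncomputable def compoundPoisson (s : ℝ) (N : Measure (Fin k → ℝ≥0)) : Measure (Fin k → ℝ≥0) :=
  (Real.exp (-N.real univ)).toNNReal •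
    Measure.sum fun n : ℕ => (n.factorial : ℝ≥0)⁻¹ • kingmanPow s N n

lemma hasSum_inv_factorial_mul_pow (y : ℝ) :
    HasSum (fun n : ℕ => (n.factorial : ℝ)⁻¹ * y ^ n) (Real.exp y) := by
  simpa only [Real.exp_eq_exp_ℝ, div_eq_inv_mul] using NormedSpace.expSeries_div_hasSum_exp y

lemma sum_inv_factorial_smul_kingmanPow_univ (hs : -(1 / 2) ≤ s) (N : Measure (Fin k → ℝ≥0))
    [IsFiniteMeasure N] :
    (Measure.sum fun n : ℕ => (n.factorial : ℝ≥0)⁻¹ • kingmanPow s N n) univ =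
      ENNReal.ofReal (Real.exp (N.real univ)) := by
  have hterm (n : ℕ) : ((n.factorial : ℝ≥0)⁻¹ • kingmanPow s N n) univ =
      ENNReal.ofReal ((n.factorial : ℝ)⁻¹ * N.real univ ^ n) := by
    rw [Measure.smul_apply, kingmanPow_univ hs, ENNReal.smul_def, smul_eq_mul,
      ENNReal.ofReal_mul (by positivity), ENNReal.ofReal_pow (by positivity), ofReal_measureReal,
      ← ENNReal.ofReal_coe_nnreal, NNReal.coe_inv, NNReal.coe_natCast]
  have hsum := hasSum_inv_factorial_mul_pow (N.real univ)
  simp only [Measure.sum_apply _ MeasurableSet.univ, hterm]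
  rw [← ENNReal.ofReal_tsum_of_nonneg (fun n => by positivity) hsum.summable, hsum.tsum_eq]

lemma isProbabilityMeasure_compoundPoisson (hs : -(1 / 2) ≤ s) (N : Measure (Fin k → ℝ≥0))
    [IsFiniteMeasure N] : IsProbabilityMeasure (compoundPoisson s N) := by
  constructor
  rw [compoundPoisson, Measure.smul_apply, sum_inv_factorial_smul_kingmanPow_univ hs,
    ENNReal.smul_def, smul_eq_mul, ← ENNReal.ofReal, ← ENNReal.ofReal_mul (Real.exp_pos _).le,
    ← Real.exp_add, neg_add_cancel, Real.exp_zero, ENNReal.ofReal_one]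

lemma radCharFun_smul (c : ℝ≥0) (N : Measure (Fin k → ℝ≥0)) (t : Fin k → ℝ≥0) :
    radCharFun s (c • N) t = c * radCharFun s N t := by
  rw [radCharFun, integral_smul_nnreal_measure, NNReal.smul_def, smul_eq_mul, radCharFun]

lemma hasSum_radCharFun (hs : -(1 / 2) ≤ s) (N : ℕ → Measure (Fin k → ℝ≥0))
    [IsFiniteMeasure (Measure.sum N)] (t : Fin k → ℝ≥0) :
    HasSum (fun n => radCharFun s (N n) t) (radCharFun s (Measure.sum N) t) :=
  hasSum_integral_measure (integrable_kingmanKernelPi hs _ t)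

lemma radCharFun_compoundPoisson (hs : -(1 / 2) ≤ s) (N : Measure (Fin k → ℝ≥0))
    [IsFiniteMeasure N] (t : Fin k → ℝ≥0) :
    radCharFun s (compoundPoisson s N) t =
      Real.exp (-∫ x, (1 - kingmanKernelPi s t x) ∂N) := by
  have : IsFiniteMeasure (Measure.sum fun n : ℕ => (n.factorial : ℝ≥0)⁻¹ • kingmanPow s N n) :=
    ⟨by simp [sum_inv_factorial_smul_kingmanPow_univ hs]⟩
  have hsum := hasSum_radCharFun hs (fun n => (n.factorial : ℝ≥0)⁻¹ • kingmanPow s N n) t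
  simp only [radCharFun_smul, radCharFun_kingmanPow hs, NNReal.coe_inv, NNReal.coe_natCast] at hsum
  rw [compoundPoisson, radCharFun_smul, hsum.unique (hasSum_inv_factorial_mul_pow _),
    Real.coe_toNNReal _ (Real.exp_pos _).le, ← Real.exp_add, integral_one_sub_kingmanKernelPi hs]
  congr 1
  ring

/-- The Lévy–Khinchine exponent `-log μ̂(t)` of a law `μ` represented by `[M, l]`. -/
noncomputable def levyExponent (s : ℝ) (M : Measure (Fin k → ℝ≥0)) (l t : Fin k → ℝ≥0) : ℝ :=
  ∑ j, (l j : ℝ) ^ 2 * (t j : ℝ) ^ 2 + ∫ x, levyIntegrand s t x ∂M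

lemma continuous_levyIntegrand_left (hs : -(1 / 2) ≤ s) (x : Fin k → ℝ≥0) :
    Continuous fun t => levyIntegrand s t x := by
  simp only [levyIntegrand, kingmanKernelPi_comm s _ x]
  have := continuous_kingmanKernelPi hs x
  fun_prop

lemma tendsto_integral_levyIntegrand_nhds_zero (hs : -(1 / 2) ≤ s) (M : Measure (Fin k → ℝ≥0))
    [IsFiniteMeasure M] : Tendsto (fun t => ∫ x, levyIntegrand s t x ∂M) (𝓝 0) (𝓝 0) := by
  rw [← integral_zero (Fin k → ℝ≥0) ℝ (μ := M)]
  refine tendsto_integral_filter_of_dominated_convergence (fun _ => 3) ?_ ?_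
    (integrable_const _) (.of_forall fun x => ?_)
  · exact .of_forall fun t => (measurable_levyIntegrand hs t).aestronglyMeasurable
  · filter_upwards [tendsto_coneNormSq.eventually_lt_const one_pos] with t ht
    exact .of_forall fun x => (norm_levyIntegrand_le hs t x).trans (by linarith)
  · simpa [levyIntegrand, kingmanKernelPi_zero_left hs] using
      (continuous_levyIntegrand_left hs x).tendsto 0

lemma tendsto_levyExponent_nhds_zero (hs : -(1 / 2) ≤ s) (M : Measure (Fin k → ℝ≥0))
    [IsFiniteMeasure M] (l : Fin k → ℝ≥0) : Tendsto (levyExponent s M l) (𝓝 0) (𝓝 0) := by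
  have hquad : Continuous fun t : Fin k → ℝ≥0 => ∑ j, (l j : ℝ) ^ 2 * (t j : ℝ) ^ 2 := by fun_prop
  unfold levyExponent
  simpa using (hquad.tendsto 0).add (tendsto_integral_levyIntegrand_nhds_zero hs M)

lemma levyExponent_restrict_le (hs : -(1 / 2) ≤ s) (M : Measure (Fin k → ℝ≥0))
    [IsFiniteMeasure M] (l t : Fin k → ℝ≥0) (A : Set (Fin k → ℝ≥0)) :
    levyExponent s (M.restrict A) l t ≤ levyExponent s M l t :=
  add_le_add le_rfl (setIntegral_le_integral (integrable_levyIntegrand hs M t)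
    (.of_forall fun x => levyIntegrand_nonneg hs t x))

lemma levyExponent_inv_natCast_smul {m : ℕ} (M : Measure (Fin k → ℝ≥0)) (l t : Fin k → ℝ≥0) :
    levyExponent s ((m : ℝ≥0)⁻¹ • M) (fun j => l j * NNReal.sqrt (m : ℝ≥0)⁻¹) t =
      (m : ℝ)⁻¹ * levyExponent s M l t := by
  rw [levyExponent, levyExponent, integral_smul_nnreal_measure, mul_add, Finset.mul_sum]
  congr 1
  refine Finset.sum_congr rfl fun j _ => ?_
  rw [NNReal.coe_mul, mul_pow, Real.coe_sqrt, Real.sq_sqrt (NNReal.coe_nonneg _), NNReal.coe_inv,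
    NNReal.coe_natCast]
  ring

lemma measurableSet_le_coneNormSq (ε : ℝ) : MeasurableSet {x : Fin k → ℝ≥0 | ε ≤ coneNormSq x} :=
  measurableSet_le measurable_const measurable_coneNormSq

/-- The measure `(1 + ‖x‖²) / ‖x‖² M(dx)`, which is the intensity of jumps of a law represented by
`[M, l]`. -/
noncomputable def jumpIntensity (M : Measure (Fin k → ℝ≥0)) : Measure (Fin k → ℝ≥0) :=
  M.withDensity fun x => ENNReal.ofReal ((1 + coneNormSq x) / coneNormSq x)

lemma measurable_one_add_coneNormSq_div :
    Measurable fun x : Fin k → ℝ≥0 => (1 + coneNormSq x) / coneNormSq x :=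
  (measurable_const.add measurable_coneNormSq).div measurable_coneNormSq

lemma integral_one_sub_kingmanKernelPi_jumpIntensity (M : Measure (Fin k → ℝ≥0))
    (t : Fin k → ℝ≥0) :
    ∫ x, (1 - kingmanKernelPi s t x) ∂jumpIntensity M = ∫ x, levyIntegrand s t x ∂M := by
  rw [jumpIntensity, integral_withDensity_eq_integral_toReal_smul
    measurable_one_add_coneNormSq_div.ennreal_ofReal (by simp)]
  refine integral_congr_ae (.of_forall fun x => ?_)
  simp only [ENNReal.toReal_ofReal (one_add_coneNormSq_div_nonneg x), smul_eq_mul, levyIntegrand,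
    mul_comm]

lemma isFiniteMeasure_jumpIntensity_restrict (M : Measure (Fin k → ℝ≥0)) [IsFiniteMeasure M]
    {ε : ℝ} (hε : 0 < ε) :
    IsFiniteMeasure (jumpIntensity (M.restrict {x | ε ≤ coneNormSq x})) := by
  have hint : Integrable (fun x => (1 + coneNormSq x) / coneNormSq x)
      (M.restrict {x | ε ≤ coneNormSq x}) := by
    refine Integrable.of_bound measurable_one_add_coneNormSq_div.aestronglyMeasurable (1 / ε + 1) ?_
    filter_upwards [ae_restrict_mem (measurableSet_le_coneNormSq ε)] with x hx
    replace hx : ε ≤ coneNormSq x := hx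
    rw [Real.norm_of_nonneg (one_add_coneNormSq_div_nonneg x), add_div,
      div_self (hε.trans_le hx).ne']
    gcongr
  exact isFiniteMeasure_withDensity hint.lintegral_lt_top.ne

lemma exists_radCharFun_eq_exp_of_isFiniteMeasure_jumpIntensity (hs : -(1 / 2) ≤ s)
    (M : Measure (Fin k → ℝ≥0)) [IsFiniteMeasure (jumpIntensity M)] (l : Fin k → ℝ≥0) :
    ∃ ν : Measure (Fin k → ℝ≥0), IsProbabilityMeasure ν ∧
      ∀ t, radCharFun s ν t = Real.exp (-levyExponent s M l t) := by
  have := isProbabilityMeasure_gaussMixing hs fun j => l j ^ 2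
  have := isProbabilityMeasure_compoundPoisson hs (jumpIntensity M)
  refine ⟨kingmanConv s (gaussMixing s fun j => l j ^ 2) (compoundPoisson s (jumpIntensity M)),
    isProbabilityMeasure_kingmanConv hs _ _, fun t => ?_⟩
  rw [radCharFun_kingmanConv hs, radCharFun_gaussMixing hs, radCharFun_compoundPoisson hs,
    integral_one_sub_kingmanKernelPi_jumpIntensity, gaussFun, ← Real.exp_add, ← neg_add]
  simp only [NNReal.coe_pow, levyExponent]

lemma tendsto_setIntegral_levyIntegrand (hs : -(1 / 2) ≤ s) (M : Measure (Fin k → ℝ≥0))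
    [IsFiniteMeasure M] (t : Fin k → ℝ≥0) :
    Tendsto (fun n : ℕ => ∫ x in {x | 1 / ((n : ℝ) + 1) ≤ coneNormSq x}, levyIntegrand s t x ∂M)
      atTop (𝓝 (∫ x, levyIntegrand s t x ∂M)) := by
  simp only [← integral_indicator (measurableSet_le_coneNormSq _)]
  refine tendsto_integral_of_dominated_convergence (fun x => ‖levyIntegrand s t x‖) (fun n => ?_)
    (integrable_levyIntegrand hs M t).norm
    (fun n => .of_forall fun x => norm_indicator_le_norm_self _ _) (.of_forall fun x => ?_)
  · exact ((measurable_levyIntegrand hs t).indicator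
      (measurableSet_le_coneNormSq _)).aestronglyMeasurable
  · rcases eq_or_ne x 0 with rfl | hx
    · simp [indicator_apply, levyIntegrand, kingmanKernelPi_zero_right hs]
    · refine tendsto_const_nhds.congr' ?_
      filter_upwards [(tendsto_one_div_add_atTop_nhds_zero_nat (𝕜 := ℝ)).eventually_lt_const
        (coneNormSq_pos hx)] with n hn
      exact (indicator_of_mem (s := {x | 1 / ((n : ℝ) + 1) ≤ coneNormSq x}) hn.le _).symm

lemma hasUniformQuadraticBound_of_radCharFun_eq_exp {ι : Type*} (hs : -(1 / 2) ≤ s)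
    {ν : ι → Measure (Fin k → ℝ≥0)} [∀ i, IsProbabilityMeasure (ν i)]
    {ψ : ι → (Fin k → ℝ≥0) → ℝ} {φ : (Fin k → ℝ≥0) → ℝ}
    (hν : ∀ i t, radCharFun s (ν i) t = Real.exp (-ψ i t)) (hψ : ∀ i t, ψ i t ≤ φ t)
    (hφ : Tendsto φ (𝓝 0) (𝓝 0)) : HasUniformQuadraticBound s ν := by
  refine hasUniformQuadraticBound_of_le hs ν hφ (.of_forall fun t i => ?_)
  rw [integral_one_sub_kingmanKernelPi hs, hν, probReal_univ]
  linarith [Real.add_one_le_exp (-ψ i t), hψ i t]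

/-- The truncations of `M` away from the origin give laws whose exponents increase to that of
`[M, l]`, and domination by the limit makes them tight. -/
theorem exists_radCharFun_eq_exp_neg_levyExponent (hs : -(1 / 2) ≤ s)
    (M : Measure (Fin k → ℝ≥0)) [IsFiniteMeasure M] (l : Fin k → ℝ≥0) :
    ∃ ν : Measure (Fin k → ℝ≥0), IsProbabilityMeasure ν ∧
      ∀ t, radCharFun s ν t = Real.exp (-levyExponent s M l t) := by
  have := fun n : ℕ => isFiniteMeasure_jumpIntensity_restrict M
    (Nat.one_div_pos_of_nat (α := ℝ) (n := n))
  choose ν hν hνt using fun n : ℕ => exists_radCharFun_eq_exp_of_isFiniteMeasure_jumpIntensity hs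
    (M.restrict {x | 1 / ((n : ℝ) + 1) ≤ coneNormSq x}) l
  have hbound := hasUniformQuadraticBound_of_radCharFun_eq_exp hs hνt
    (fun n t => levyExponent_restrict_le hs M l t _) (tendsto_levyExponent_nhds_zero hs M l)
  obtain ⟨Q, -, hlim⟩ := exists_tendsto_hyperfilter (C := 1) ν (fun n => prob_le_one)
    fun ε hε => hbound.exists_isCompact hs hε
  refine ⟨Q, ?_, fun t => ?_⟩
  · have := hlim (fun _ => 1) continuous_const ⟨1, by simp⟩
    simp only [integral_const, probReal_univ, smul_eq_mul, mul_one] at this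
    exact isProbabilityMeasure_iff_real.2 (tendsto_nhds_unique this tendsto_const_nhds)
  · have hlimQ := hlim (kingmanKernelPi s t) (continuous_kingmanKernelPi hs t)
      ⟨1, abs_kingmanKernelPi_le_one hs t⟩
    have hlimExp : Tendsto (fun n => radCharFun s (ν n) t) atTop
        (𝓝 (Real.exp (-levyExponent s M l t))) := by
      simp only [hνt, levyExponent]
      exact ((tendsto_setIntegral_levyIntegrand hs M t).const_add _).neg.rexp
    exact tendsto_nhds_unique hlimQ (hlimExp.mono_left Nat.hyperfilter_le_atTop)

theorem HasLevyRep.isKingmanID (hs : -(1 / 2) ≤ s) {μ M : Measure (Fin k → ℝ≥0)}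
    [IsProbabilityMeasure μ] {l : Fin k → ℝ≥0} (h : HasLevyRep s μ M l) : IsKingmanID s μ := by
  have := h.isFiniteMeasure hs
  intro m hm
  have hm0 : (m : ℝ) ≠ 0 := Nat.cast_ne_zero.2 (Nat.one_le_iff_ne_zero.1 hm)
  obtain ⟨ν, hν, hνt⟩ := exists_radCharFun_eq_exp_neg_levyExponent hs ((m : ℝ≥0)⁻¹ • M)
    fun j => l j * NNReal.sqrt (m : ℝ≥0)⁻¹
  have := isProbabilityMeasure_kingmanPow hs ν m
  refine ⟨ν, hν, ext_of_radCharFun hs fun t => ?_⟩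
  rw [radCharFun_kingmanPow hs, hνt, levyExponent_inv_natCast_smul, ← Real.exp_nat_mul, mul_neg,
    mul_inv_cancel_left₀ hm0, levyExponent, ← h.eq t, neg_neg, Real.exp_log (h.pos t)]

end Attained

theorem mainTheorem3 (k : ℕ) (hk : 1 ≤ k) (s : ℝ) (hs : -(1 / 2) ≤ s)
    (μ : Measure (Fin k → ℝ≥0)) [IsProbabilityMeasure μ] :
    (IsKingmanID s μ ↔ ∃ (M : Measure (Fin k → ℝ≥0)) (l : Fin k → ℝ≥0), HasLevyRep s μ M l) ∧
    (∀ (M M' : Measure (Fin k → ℝ≥0)) (l l' : Fin k → ℝ≥0),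
      HasLevyRep s μ M l → HasLevyRep s μ M' l' → M = M' ∧ l = l') ∧
    ((∃ l : Fin k → ℝ≥0, HasLevyRep s μ 0 l) ↔ IsRayleighian s μ) ∧
    (IsRayleighian s μ ↔ ∃ l : Fin k → ℝ≥0, ∀ t : Fin k → ℝ≥0,
      0 < radCharFun s μ t ∧
        -Real.log (radCharFun s μ t) = 1 / 2 * ∑ j, (l j : ℝ) ^ 2 * (t j : ℝ) ^ 2) :=
  ⟨⟨fun h => h.exists_hasLevyRep hs, fun ⟨_, _, h⟩ => h.isKingmanID hs⟩,
    fun _ _ _ _ h h' => h.unique hs h', exists_hasLevyRep_zero_iff hs μ,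
    isRayleighian_iff_neg_log hs μ (half_pos one_pos)⟩
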